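/- Let $m\ge 3$ be an integer. For $d\ge 0$ let $\mathcal Q_2^d$ be the vector space of complex binary forms of degree $d$ in $z_1,z_2$, with the Zariski topology, and let $C\in\mathrm{GL}(2,\mathbb C)$ act on it by $Q\mapsto Q_C$, $Q_C(z)=Q\bigl(z\,(C^{-1})^T\bigr)$, where $z=(z_1,z_2)$ is a row vector. Let $X_2^m\subset\mathcal Q_2^m$ be the set of forms with non-zero discriminant; up to a non-zero constant factor, the discriminant of $Q$ is the resultant of $\partial Q/\partial z_1$ and $\partial Q/\partial z_2$, regarded as binary forms of degree $m-1$. For $Q\in X_2^m$ let $M(Q)=\mathbb C[z_1,z_2]/(\partial Q/\partial z_1,\partial Q/\partial z_2)$ be its Milnor algebra, let $\mathfrak m\subset M(Q)$ be the maximal ideal of elements represented by polynomials vanishing at the origin, and let $\mathrm{Soc}(M(Q))=\{x\in\mathfrak m: x\,\mathfrak m=0\}$, which is a complex line spanned by the class $e_0$ of the Hessian determinant of $Q$. Let $\omega:\mathrm{Soc}(M(Q))\to\mathbb C$ be the linear isomorphism with $\omega(e_0)=1$. The associated form $\mathbf Q\in\mathcal Q_2^{2(m-2)}$ of $Q$ is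 $$\mathbf Q(z_1,z_2)=\omega\bigl((z_1e_1+z_2e_2)^{2(m-2)}\bigr),$$ where $e_j\in M(Q)$ is the class of the coordinate function $z_j$. For $N\ge 1$ the catalecticant of $F=\sum_{j=0}^{2N}\binom{2N}{j}a_jz_1^{2N-j}z_2^j$ is $\mathrm{Cat}(F)=\det(a_{i+j})_{0\le i,j\le N}$; put $Y_2^{2N}=\{F\in\mathcal Q_2^{2N}:\mathrm{Cat}(F)\ne 0\}$. Then for every $Q\in X_2^m$ the orbit $\{\mathbf Q_C: C\in\mathrm{GL}(2,\mathbb C)\}$ of the associated form $\mathbf Q$ is contained in $Y_2^{2(m-2)}$ and is closed in $Y_2^{2(m-2)}$ in the Zariski topology. -/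

import Mathlib

open scoped MatrixGroups

noncomputable section

namespace AssocForm

open MvPolynomial

/-- The complex vector space of forms (homogeneous polynomials) of degree `d` on `ℂⁿ`. -/
abbrev Form (n d : ℕ) : Type := homogeneousSubmodule (Fin n) ℂ d

/-! ### The Zariski topology on the space of forms -/

/-- The set of forms at which all members of `S` vanish. The members of `S` are polynomials in the
coefficients of a form, the variable indexed by `s` standing for the coefficient of `z ^ s`. -/
def zeroSet (n d : ℕ) (S : Set (MvPolynomial (Fin n →₀ ℕ) ℂ)) : Set (Form n d) :=
  {F | ∀ p ∈ S, eval (fun s => coeff s F.1) p = 0}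

/-- The Zariski topology on the affine space of forms: the closed sets are the zero sets of
families of polynomials in the coefficients. -/
instance zariskiTopology (n d : ℕ) : TopologicalSpace (Form n d) :=
  TopologicalSpace.ofClosed (Set.range (zeroSet n d))
    ⟨{1}, by ext F; simp [zeroSet]⟩
    (by
      intro A hA
      refine ⟨⋃₀ {S | zeroSet n d S ∈ A}, ?_⟩
      ext F
      constructor
      · intro h Z hZ
        obtain ⟨S, rfl⟩ := hA hZ
        exact fun p hp => h p ⟨S, hZ, hp⟩
      · rintro h p ⟨S, hS, hp⟩
        exact h _ hS p hp)
    (by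
      rintro _ ⟨S, rfl⟩ _ ⟨T, rfl⟩
      refine ⟨{r | ∃ p ∈ S, ∃ q ∈ T, r = p * q}, ?_⟩
      ext F
      constructor
      · intro h
        by_cases hS : F ∈ zeroSet n d S
        · exact Or.inl hS
        · refine Or.inr fun q hq => ?_
          simp only [zeroSet, Set.mem_ofPred_eq, not_forall] at hS
          obtain ⟨p, hp, hpF⟩ := hS
          have := h _ ⟨p, hp, q, hq, rfl⟩
          rw [map_mul] at this
          exact (mul_eq_zero.mp this).resolve_left hpF
      · rintro (h | h) _ ⟨p, hp, q, hq, rfl⟩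
        · rw [map_mul, h p hp, zero_mul]
        · rw [map_mul, h q hq, mul_zero])

/-! ### The action of the general linear group -/

/-- The polynomial `Q_C(z) = Q(z (C⁻¹)ᵀ)` with `z` a row vector: the `j`-th variable is replaced
by `∑ i, z i * (C⁻¹) j i`. -/
def substPoly {n : ℕ} (C : GL (Fin n) ℂ) (Q : MvPolynomial (Fin n) ℂ) : MvPolynomial (Fin n) ℂ :=
  bind₁ (fun j => ∑ i, X i * MvPolynomial.C ((C⁻¹).1 j i)) Q

theorem substPoly_isHomogeneous {n d : ℕ} (C : GL (Fin n) ℂ) {Q : MvPolynomial (Fin n) ℂ}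
    (hQ : Q.IsHomogeneous d) : (substPoly C Q).IsHomogeneous d := by
  have h := hQ.aeval (fun j => ∑ i, X i * MvPolynomial.C ((C⁻¹).1 j i)) (n := 1) (fun j =>
    IsHomogeneous.sum _ _ _ fun i _ =>
      (isHomogeneous_X ℂ i).mul (isHomogeneous_C (Fin n) ((C⁻¹).1 j i)))
  rw [one_mul] at h
  exact h

/-- The form `Q_C`. -/
def subst {n d : ℕ} (C : GL (Fin n) ℂ) (Q : Form n d) : Form n d :=
  ⟨substPoly C Q.1, substPoly_isHomogeneous C Q.2⟩

/-- The orbit of a form under the general linear group. -/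
def glOrbit {n d : ℕ} (Q : Form n d) : Set (Form n d) :=
  Set.range fun C : GL (Fin n) ℂ => subst C Q

/-! ### The Milnor algebra and the associated form -/

/-- The Jacobian ideal, generated by the first-order partial derivatives. -/
def jacobianIdeal {n : ℕ} (Q : MvPolynomial (Fin n) ℂ) : Ideal (MvPolynomial (Fin n) ℂ) :=
  Ideal.span (Set.range fun j => pderiv j Q)

/-- The Milnor algebra. -/
abbrev Milnor {n : ℕ} (Q : MvPolynomial (Fin n) ℂ) : Type :=
  MvPolynomial (Fin n) ℂ ⧸ jacobianIdeal Q

/-- The class of a polynomial in the Milnor algebra. -/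
def cls {n : ℕ} (Q P : MvPolynomial (Fin n) ℂ) : Milnor Q :=
  Ideal.Quotient.mk (jacobianIdeal Q) P

/-- The ideal of elements represented by polynomials vanishing at the origin. -/
def maxIdeal {n : ℕ} (Q : MvPolynomial (Fin n) ℂ) : Ideal (Milnor Q) :=
  (RingHom.ker (constantCoeff (R := ℂ) (σ := Fin n))).map (Ideal.Quotient.mk (jacobianIdeal Q))

/-- The socle `{x ∈ 𝔪 : x 𝔪 = 0}` of the Milnor algebra, a complex vector space. -/
def socle {n : ℕ} (Q : MvPolynomial (Fin n) ℂ) : Submodule ℂ (Milnor Q) where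
  carrier := {x | x ∈ maxIdeal Q ∧ ∀ y ∈ maxIdeal Q, x * y = 0}
  zero_mem' := ⟨zero_mem _, fun y _ => zero_mul y⟩
  add_mem' := fun ha hb =>
    ⟨add_mem ha.1 hb.1, fun y hy => by rw [add_mul, ha.2 y hy, hb.2 y hy, add_zero]⟩
  smul_mem' := fun c x hx =>
    ⟨Submodule.smul_of_tower_mem _ c hx.1, fun y hy => by
      rw [smul_mul_assoc, hx.2 y hy, smul_zero]⟩

/-- The Hessian determinant. -/
def hessian {n : ℕ} (Q : MvPolynomial (Fin n) ℂ) : MvPolynomial (Fin n) ℂ :=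
  (Matrix.of fun i j => pderiv i (pderiv j Q)).det

/-- `F` is the associated form of `Q`: it is given by
`F(z) = ω((z₁ e₁ + ⋯ + zₙ eₙ) ^ (n (m - 2)))`, where `eⱼ` is the class of the `j`-th coordinate
and `ω` is the linear isomorphism from the socle to `ℂ` that takes the class of the Hessian to 1.
(Such an `ω` is unique when it exists, and `F` is determined by its values.) -/
def IsAssociatedForm {n m : ℕ} (Q : Form n m) (F : Form n (n * (m - 2))) : Prop :=
  ∃ ω : socle Q.1 ≃ₗ[ℂ] ℂ,
    (∃ h : cls Q.1 (hessian Q.1) ∈ socle Q.1, ω ⟨_, h⟩ = 1) ∧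
    ∀ z : Fin n → ℂ, ∃ h : (∑ j, z j • cls Q.1 (X j)) ^ (n * (m - 2)) ∈ socle Q.1,
      eval z F.1 = ω ⟨_, h⟩

open Classical in
/-- The associated form of `Q` (with the value 0 for those `Q` that have no associated form). -/
def associatedForm {n m : ℕ} (Q : Form n m) : Form n (n * (m - 2)) :=
  if h : ∃ F, IsAssociatedForm Q F then h.choose else 0

/-! ### Binary forms: discriminant and catalecticant -/

/-- The discriminant of a binary form of degree `m`, up to a non-zero constant factor depending
only on `m`: the resultant of the two partial derivatives, as binary forms of degree `m - 1`
(written in the affine coordinate `z₁ = t`, `z₂ = 1`, with formal degrees `m - 1`). -/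
def discriminant {m : ℕ} (Q : Form 2 m) : ℂ :=
  Polynomial.resultant
    (aeval ![Polynomial.X, (1 : Polynomial ℂ)] (pderiv 0 Q.1))
    (aeval ![Polynomial.X, (1 : Polynomial ℂ)] (pderiv 1 Q.1)) (m - 1) (m - 1)

/-- The set of binary forms of degree `m` with non-zero discriminant. -/
def nondegenerateForms (m : ℕ) : Set (Form 2 m) := {Q | discriminant Q ≠ 0}

/-- The coefficient `aⱼ` of a binary form `∑ j, (d choose j) aⱼ z₁ ^ (d - j) z₂ ^ j`. -/
def normCoeff {d : ℕ} (F : Form 2 d) (j : ℕ) : ℂ :=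
  coeff (Finsupp.single 0 (d - j) + Finsupp.single 1 j) F.1 / (d.choose j : ℂ)

/-- The catalecticant `det (a_{i+j})`, `0 ≤ i, j ≤ N`, of a binary form of degree `2N`. -/
def catalecticant {N : ℕ} (F : Form 2 (2 * N)) : ℂ :=
  (Matrix.of fun i j : Fin (N + 1) => normCoeff F (i.1 + j.1)).det

/-- The affine variety of binary forms of degree `2N` with non-zero catalecticant; as a subtype it
carries the subspace topology of the Zariski topology. -/
def nonzeroCat (N : ℕ) : Set (Form 2 (2 * N)) := {F | catalecticant F ≠ 0}

end AssocForm

end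

noncomputable section

namespace AssocForm

open MvPolynomial

/-! Put `N = m - 2`, let `F` be the associated form and let `⟨F, ·⟩` be the apolar functional
`pairing F` on forms of degree `2N`. Non-zero resultant makes the partial derivatives of `Q` a
coprime pair whose ideal contains all forms of degree `2N + 1`, and the socle of the quotient is
spanned by the Hessian. Hence `⟨F, P⟩ = 0` exactly when `P` lies in the Jacobian ideal, and by
induction on the codegree a form annihilated by `F` lies in that ideal. Since the ideal starts in
degree `m - 1 = N + 1`, the catalecticant pairing on degree `N` is nondegenerate, and the forms of
degree `N + 1` apolar to `F` are the combinations of the two partials.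

A form with non-zero catalecticant is determined up to scale by its apolar forms of degree `N + 1`
(`exists_pairing_eq_mul`), and these have no common zero (`exists_isApolar_eval_ne_zero`).
Closedness follows by elimination (`exists_polyFun_of_no_common_zero`) once membership in the orbit
is expressed as a system with coefficients polynomial in `G`, homogeneous in the unknowns and having
a non-zero solution. There are two cases.

If no `(N + 1)`-st power of a non-zero linear form is apolar to `F`, the unknown is a `2 × 2` matrix
`A` whose substitution carries the apolar forms of `G` to apolar forms of `F`. A solution of rank
one would make such a power apolar to `F`, so every non-zero solution is invertible and places `G`
in the orbit (`mem_glOrbit_of_pairing_lsub`, `exists_polyFun_of_stable`).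

Otherwise some derivative of `Q` is `l ^ (m - 1)`. Then `Q` is a combination of `m`-th powers of two
independent linear forms, and `F` is a multiple of the `N`-th power of their product in dual
coordinates (`exists_associatedForm_eq_of_linForm_pow`). The orbit consists of multiples of `N`-th
powers of nondegenerate quadratic forms. The unknown is now the quadratic form, and degenerate ones
are excluded because powers of linear forms have zero catalecticant
(`exists_polyFun_of_polystable`). -/

/-! ### Elimination -/

/-- A function on the space of forms that is polynomial in the coefficients. -/
def IsPolyFun {n d : ℕ} (φ : Form n d → ℂ) : Prop :=
  ∃ p : MvPolynomial (Fin n →₀ ℕ) ℂ, ∀ F : Form n d, φ F = eval (fun s => coeff s F.1) p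

namespace IsPolyFun

variable {n d : ℕ} {φ ψ : Form n d → ℂ}

theorem const (c : ℂ) : IsPolyFun (fun _ : Form n d => c) := ⟨C c, fun F => by simp⟩

theorem coeff (s : Fin n →₀ ℕ) : IsPolyFun (fun F : Form n d => MvPolynomial.coeff s F.1) :=
  ⟨X s, fun F => by simp⟩

theorem add (hφ : IsPolyFun φ) (hψ : IsPolyFun ψ) : IsPolyFun (fun F => φ F + ψ F) := by
  obtain ⟨p, hp⟩ := hφ
  obtain ⟨q, hq⟩ := hψ
  exact ⟨p + q, fun F => by simp [hp, hq]⟩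

theorem mul (hφ : IsPolyFun φ) (hψ : IsPolyFun ψ) : IsPolyFun (fun F => φ F * ψ F) := by
  obtain ⟨p, hp⟩ := hφ
  obtain ⟨q, hq⟩ := hψ
  exact ⟨p * q, fun F => by simp [hp, hq]⟩

theorem neg (hφ : IsPolyFun φ) : IsPolyFun (fun F => -φ F) := by
  simpa using (const (-1)).mul hφ

theorem sum {ι : Type*} (s : Finset ι) {φ : ι → Form n d → ℂ} (h : ∀ i ∈ s, IsPolyFun (φ i)) :
    IsPolyFun (fun F => ∑ i ∈ s, φ i F) := by
  classical
  induction s using Finset.induction_on with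
  | empty => simpa using const 0
  | insert a s ha ih =>
    simp only [Finset.sum_insert ha]
    exact (h a (by simp)).add (ih fun i hi => h i (by simp [hi]))

theorem prod {ι : Type*} (s : Finset ι) {φ : ι → Form n d → ℂ} (h : ∀ i ∈ s, IsPolyFun (φ i)) :
    IsPolyFun (fun F => ∏ i ∈ s, φ i F) := by
  classical
  induction s using Finset.induction_on with
  | empty => simpa using const 1
  | insert a s ha ih =>
    simp only [Finset.prod_insert ha]
    exact (h a (by simp)).mul (ih fun i hi => h i (by simp [hi]))

theorem det {ι : Type*} [Fintype ι] [DecidableEq ι] {M : Form n d → Matrix ι ι ℂ}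
    (h : ∀ i j, IsPolyFun (fun F => M F i j)) : IsPolyFun (fun F => (M F).det) := by
  simp only [Matrix.det_apply']
  exact sum _ fun σ _ => (const _).mul (prod _ fun i _ => h _ _)

theorem adjugate {ι : Type*} [Fintype ι] [DecidableEq ι] {M : Form n d → Matrix ι ι ℂ}
    (h : ∀ i j, IsPolyFun (fun F => M F i j)) (i j : ι) :
    IsPolyFun (fun F => (M F).adjugate i j) := by
  simp only [Matrix.adjugate_apply]
  refine det fun a b => ?_
  simp only [Matrix.updateRow_apply]
  split_ifs
  · exact const _
  · exact h _ _

end IsPolyFun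

/-- A function that is given by a homogeneous polynomial of degree `e`. -/
def IsHomPolyFun {σ : Type*} (e : ℕ) (g : (σ → ℂ) → ℂ) : Prop :=
  ∃ p : MvPolynomial σ ℂ, p.IsHomogeneous e ∧ ∀ x, g x = eval x p

namespace IsHomPolyFun

variable {σ : Type*} {e e' : ℕ} {g g' : (σ → ℂ) → ℂ}

theorem zero : IsHomPolyFun e (fun _ : σ → ℂ => (0 : ℂ)) :=
  ⟨0, isHomogeneous_zero _ _ _, fun x => by simp⟩

theorem const (c : ℂ) : IsHomPolyFun 0 (fun _ : σ → ℂ => c) :=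
  ⟨C c, isHomogeneous_C _ _, fun x => by simp⟩

theorem proj (i : σ) : IsHomPolyFun 1 (fun x : σ → ℂ => x i) :=
  ⟨X i, isHomogeneous_X _ _, fun x => by simp⟩

theorem add (hg : IsHomPolyFun e g) (hg' : IsHomPolyFun e g') :
    IsHomPolyFun e (fun x => g x + g' x) := by
  obtain ⟨p, hp, hp'⟩ := hg
  obtain ⟨q, hq, hq'⟩ := hg'
  exact ⟨p + q, hp.add hq, fun x => by simp [hp', hq']⟩

theorem mul (hg : IsHomPolyFun e g) (hg' : IsHomPolyFun e' g') :
    IsHomPolyFun (e + e') (fun x => g x * g' x) := by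
  obtain ⟨p, hp, hp'⟩ := hg
  obtain ⟨q, hq, hq'⟩ := hg'
  exact ⟨p * q, hp.mul hq, fun x => by simp [hp', hq']⟩

theorem const_mul (c : ℂ) (hg : IsHomPolyFun e g) : IsHomPolyFun e (fun x => c * g x) := by
  simpa using (const c).mul hg

theorem sum {ι : Type*} (s : Finset ι) {g : ι → (σ → ℂ) → ℂ}
    (h : ∀ i ∈ s, IsHomPolyFun e (g i)) : IsHomPolyFun e (fun x => ∑ i ∈ s, g i x) := by
  classical
  induction s using Finset.induction_on with
  | empty => simpa using zero
  | insert a s ha ih =>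
    simp only [Finset.sum_insert ha]
    exact (h a (by simp)).add (ih fun i hi => h i (by simp [hi]))

/-- Coefficients of a product of two polynomials with homogeneous coefficient functions. -/
theorem coeff_mul {τ : Type*} {P P' : (σ → ℂ) → MvPolynomial τ ℂ}
    (h : ∀ s, IsHomPolyFun e (fun x => coeff s (P x)))
    (h' : ∀ s, IsHomPolyFun e' (fun x => coeff s (P' x))) (s : τ →₀ ℕ) :
    IsHomPolyFun (e + e') (fun x => coeff s (P x * P' x)) := by
  classical
  simp only [MvPolynomial.coeff_mul]
  exact sum _ fun i _ => (h _).mul (h' _)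

theorem coeff_const {τ : Type*} (P : MvPolynomial τ ℂ) (s : τ →₀ ℕ) :
    IsHomPolyFun 0 (fun _ : σ → ℂ => coeff s P) := const _

theorem coeff_pow {τ : Type*} {P : (σ → ℂ) → MvPolynomial τ ℂ}
    (h : ∀ s, IsHomPolyFun e (fun x => coeff s (P x))) (n : ℕ) (s : τ →₀ ℕ) :
    IsHomPolyFun (n * e) (fun x => coeff s (P x ^ n)) := by
  induction n generalizing s with
  | zero => simpa using coeff_const _ s
  | succ n ih =>
    simp only [pow_succ, add_mul, one_mul]
    exact coeff_mul ih h s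

end IsHomPolyFun

theorem _root_.MvPolynomial.IsHomogeneous.eval_smul {σ : Type*} {P : MvPolynomial σ ℂ} {i : ℕ}
    (hi : P.IsHomogeneous i) (c : ℂ) (x : σ → ℂ) : eval (c • x) P = c ^ i * eval x P := by
  rw [eval_eq, eval_eq, Finset.mul_sum]
  refine Finset.sum_congr rfl fun s hs => ?_
  have hd : ∑ j ∈ s.support, s j = i := (hi.degree_eq_sum_deg_support hs).symm
  simp only [Pi.smul_apply, smul_eq_mul, mul_pow, Finset.prod_mul_distrib,
    Finset.prod_pow_eq_pow_sum, hd]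
  ring

/-- Restricted to the line through `x`, `P` is a polynomial in the scalar `c` whose coefficients are
the values of the homogeneous components. It vanishes identically, so each coefficient does. -/
theorem eval_homogeneousComponent_eq_zero {σ : Type*} (P : MvPolynomial σ ℂ) (x : σ → ℂ)
    (h : ∀ c : ℂ, eval (c • x) P = 0) (M : ℕ) : eval x (homogeneousComponent M P) = 0 := by
  have key : ∀ c : ℂ, eval (c • x) P =
      ∑ i ∈ Finset.range (P.totalDegree + 1), eval x (homogeneousComponent i P) * c ^ i := by
    intro c
    conv_lhs => rw [← sum_homogeneousComponent P, map_sum]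
    refine Finset.sum_congr rfl fun i _ => ?_
    rw [(homogeneousComponent_isHomogeneous i P).eval_smul, mul_comm]
  by_cases hM : M < P.totalDegree + 1
  · set q : Polynomial ℂ := ∑ i ∈ Finset.range (P.totalDegree + 1),
      Polynomial.C (eval x (homogeneousComponent i P)) * Polynomial.X ^ i with hq
    have hq0 : q = 0 := Polynomial.funext fun c => by
      simp [hq, Polynomial.eval_finsetSum, ← key, h]
    have := congrArg (fun r => Polynomial.coeff r M) hq0
    simpa [hq, Polynomial.finsetSum_coeff, Polynomial.coeff_C_mul, Polynomial.coeff_X_pow, hM]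
      using this
  · rw [homogeneousComponent_eq_zero _ _ (by omega), map_zero]

/-- Elimination: the existence of a nontrivial common zero of homogeneous polynomials is a
closed condition on their coefficients. -/
theorem exists_polyFun_of_no_common_zero {σ ι J : Type*} [Finite σ] [Fintype J] {n d e : ℕ}
    (κ : ι → J → Form n d → ℂ) (hκ : ∀ i j, IsPolyFun (κ i j))
    (g : ι → J → (σ → ℂ) → ℂ) (hg : ∀ i j, IsHomPolyFun e (g i j)) (F₀ : Form n d)
    (h₀ : ∀ x, (∀ i, ∑ j, κ i j F₀ * g i j x = 0) → x = 0) :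
    ∃ D : Form n d → ℂ, IsPolyFun D ∧ D F₀ ≠ 0 ∧
      ∀ F x, x ≠ 0 → (∀ i, ∑ j, κ i j F * g i j x = 0) → D F = 0 := by
  classical
  choose G hGh hG using hg
  let p : ι → Form n d → MvPolynomial σ ℂ := fun i F => ∑ j, C (κ i j F) * G i j
  have hp : ∀ i F x, eval x (p i F) = ∑ j, κ i j F * g i j x := fun i F x => by simp [p, hG]
  have hph : ∀ i F, (p i F).IsHomogeneous e := fun i F =>
    IsHomogeneous.sum _ _ _ fun j _ => (hGh i j).C_mul _
  set J₀ : Ideal (MvPolynomial σ ℂ) := Ideal.span (Set.range fun i => p i F₀) with hJ₀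
  -- The Nullstellensatz: the zero locus at `F₀` is at most the origin, so some power of the ideal
  -- of the variables lies in `J₀`.
  have hrad : idealOfVars σ ℂ ≤ J₀.radical := by
    rw [← vanishingIdeal_zeroLocus_eq_radical (K := ℂ), idealOfVars, Ideal.span_le]
    rintro _ ⟨j, rfl⟩ x hx
    have : x = 0 := h₀ x fun i => by
      rw [← hp]
      exact hx _ (Ideal.subset_span ⟨i, rfl⟩)
    simp [this]
  obtain ⟨M, hM⟩ := Ideal.exists_pow_le_of_le_radical_of_fg hrad (idealOfVars_fg σ ℂ)
  let S : Type _ := {a : σ →₀ ℕ // a.degree = M}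
  have : Finite S := Finsupp.finite_of_degree_le M |>.subset (fun a ha => le_of_eq ha) |>.to_subtype
  have : Fintype S := Fintype.ofFinite S
  have hmem : ∀ a : S, ∃ h : ι →₀ MvPolynomial σ ℂ,
      (h.sum fun i r => r * p i F₀) = monomial a.1 1 := by
    intro a
    have : monomial a.1 (1 : ℂ) ∈ J₀ :=
      hM ((monomial_mem_pow_idealOfVars_iff M a.1 one_ne_zero).2 a.2.ge)
    obtain ⟨h, hh⟩ := (Finsupp.mem_ideal_span_range_iff_exists_finsupp).1 this
    exact ⟨h, hh⟩
  choose h hh using hmem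
  -- The cofactors `h a` that express the monomials of degree `M` at `F₀` are kept fixed while `F`
  -- varies. Row `a` records the degree-`M` part of the resulting combination, so `E F₀ = 1` and
  -- `det E` is polynomial in `F`.
  let E : Form n d → Matrix S S ℂ := fun F => Matrix.of fun a b =>
    coeff b.1 ((h a).sum fun i r => r * p i F)
  refine ⟨fun F => (E F).det, IsPolyFun.det fun a b => ?_, ?_, fun F x hx hxF => ?_⟩
  · simp only [E, Matrix.of_apply, Finsupp.sum, coeff_sum, p, Finset.mul_sum]
    refine IsPolyFun.sum _ fun i _ => IsPolyFun.sum _ fun j _ => ?_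
    simp only [mul_left_comm _ (C _), coeff_C_mul]
    exact (hκ i j).mul (IsPolyFun.const _)
  · have : E F₀ = 1 := by
      ext a b
      simp only [E, Matrix.of_apply, hh, coeff_monomial, Matrix.one_apply]
      exact if_congr Subtype.ext_iff.symm rfl rfl
    simp [this]
  · obtain ⟨j, hj⟩ : ∃ j, x j ≠ 0 := by
      by_contra! hcon
      exact hx (funext hcon)
    -- The kernel vector lists the values at `x` of all monomials of degree `M`; it is non-zero
    -- because `x j ^ M ≠ 0`. The rows kill it because the combinations vanish on the whole line
    -- through `x`, hence so do their degree-`M` components.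
    refine Matrix.exists_mulVec_eq_zero_iff.1
      ⟨fun b : S => b.1.prod fun i k => x i ^ k, fun h0 => ?_, ?_⟩
    · have := congrFun h0 ⟨Finsupp.single j M, by simp⟩
      simp [hj] at this
    · ext a
      have hz : ∀ c : ℂ, eval (c • x) ((h a).sum fun i r => r * p i F) = 0 := by
        intro c
        rw [Finsupp.sum, map_sum]
        refine Finset.sum_eq_zero fun i _ => ?_
        rw [map_mul, (hph i F).eval_smul, hp, hxF, mul_zero, mul_zero]
      have := eval_homogeneousComponent_eq_zero _ x hz M
      rw [homogeneousComponent_apply, map_sum] at this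
      have hT : ∑ b ∈ Finset.univ.map (Function.Embedding.subtype fun a => a.degree = M),
          eval x (monomial b (coeff b ((h a).sum fun i r => r * p i F))) =
          ∑ b : S, coeff b.1 ((h a).sum fun i r => r * p i F) * b.1.prod (fun i k => x i ^ k) := by
        rw [Finset.sum_map]
        exact Finset.sum_congr rfl fun b _ => by rw [eval_monomial]; rfl
      refine Eq.trans hT.symm (Eq.trans (Eq.symm ?_) this)
      refine Finset.sum_subset (fun b hb => ?_) fun b hb hb' => ?_
      · simpa using (Finset.mem_filter.1 hb).2
      · have hbM : b.degree = M := by simpa using hb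
        have : coeff b ((h a).sum fun i r => r * p i F) = 0 := by
          by_contra hne
          exact hb' (Finset.mem_filter.2 ⟨mem_support_iff.2 hne, hbM⟩)
        rw [this, monomial_zero, map_zero]

/-! ### Binary forms and the apolar pairing -/

theorem X_pow_mul_X_pow (a b : ℕ) : (X 0 ^ a * X 1 ^ b : MvPolynomial (Fin 2) ℂ) =
    monomial (Finsupp.single 0 a + Finsupp.single 1 b) 1 := by
  simp [X_pow_eq_monomial, monomial_mul]

theorem coeff_X_pow_mul_X_pow (a b a' b' : ℕ) :
    coeff (Finsupp.single 0 a + Finsupp.single 1 b) (X 0 ^ a' * X 1 ^ b' : MvPolynomial (Fin 2) ℂ)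
      = if a' = a ∧ b' = b then 1 else 0 := by
  rw [X_pow_mul_X_pow, coeff_monomial]
  refine if_congr ⟨fun h => ?_, fun ⟨h, h'⟩ => by rw [h, h']⟩ rfl rfl
  exact ⟨by simpa using DFunLike.congr_fun h 0, by simpa using DFunLike.congr_fun h 1⟩

theorem isHomogeneous_X_pow_mul_X_pow (a b : ℕ) :
    (X 0 ^ a * X 1 ^ b : MvPolynomial (Fin 2) ℂ).IsHomogeneous (a + b) :=
  (isHomogeneous_X_pow _ _).mul (isHomogeneous_X_pow _ _)

theorem _root_.MvPolynomial.IsHomogeneous.eq_sum_range {d : ℕ} {P : MvPolynomial (Fin 2) ℂ}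
    (hP : P.IsHomogeneous d) :
    P = ∑ j ∈ Finset.range (d + 1),
      coeff (Finsupp.single 0 (d - j) + Finsupp.single 1 j) P • (X 0 ^ (d - j) * X 1 ^ j) := by
  ext s
  have hs : s = Finsupp.single 0 (s 0) + Finsupp.single 1 (s 1) := by
    ext i; fin_cases i <;> simp
  rw [hs]
  simp only [coeff_sum, coeff_smul, coeff_X_pow_mul_X_pow, smul_eq_mul, mul_ite, mul_one, mul_zero]
  by_cases hd : s 0 + s 1 = d
  · rw [Finset.sum_eq_single (s 1)]
    · rw [if_pos ⟨by omega, rfl⟩, show d - s 1 = s 0 by omega]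
    · intro j _ hj
      rw [if_neg fun h => hj h.2]
    · intro h
      exact absurd (Finset.mem_range.2 (by omega)) h
  · rw [Finset.sum_eq_zero]
    · exact hP.coeff_eq_zero (by simpa [map_add] using hd)
    · intro j hj
      have := Finset.mem_range.1 hj
      rw [if_neg]
      omega

/-- Linear maps that agree on monomials of degree `d` agree on forms of degree `d`. -/
theorem _root_.MvPolynomial.IsHomogeneous.linearMap_ext {V : Type*} [AddCommMonoid V] [Module ℂ V]
    {d : ℕ} {P : MvPolynomial (Fin 2) ℂ} (hP : P.IsHomogeneous d)
    {φ ψ : MvPolynomial (Fin 2) ℂ →ₗ[ℂ] V}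
    (h : ∀ a b, a + b = d → φ (X 0 ^ a * X 1 ^ b) = ψ (X 0 ^ a * X 1 ^ b)) : φ P = ψ P := by
  rw [hP.eq_sum_range, map_sum, map_sum]
  refine Finset.sum_congr rfl fun j hj => ?_
  have := Finset.mem_range.1 hj
  rw [map_smul, map_smul, h _ _ (by omega)]

/-- The linear functional attached to a binary form of degree `d` by apolarity; its value at
`z₁ ^ (d - j) * z₂ ^ j` is the `j`-th normalized coefficient. -/
def pairing {d : ℕ} (F : Form 2 d) : MvPolynomial (Fin 2) ℂ →ₗ[ℂ] ℂ :=
  ∑ j ∈ Finset.range (d + 1),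
    normCoeff F j • lcoeff ℂ (Finsupp.single 0 (d - j) + Finsupp.single 1 j)

theorem pairing_X_pow_mul_X_pow {d : ℕ} (F : Form 2 d) {a b : ℕ} (h : a + b = d) :
    pairing F (X 0 ^ a * X 1 ^ b) = normCoeff F b := by
  simp only [pairing, LinearMap.sum_apply, LinearMap.smul_apply, lcoeff_apply,
    coeff_X_pow_mul_X_pow]
  rw [Finset.sum_eq_single b]
  · rw [if_pos ⟨by omega, rfl⟩, smul_eq_mul, mul_one]
  · intro j _ hj
    rw [if_neg fun h => hj h.2.symm, smul_zero]
  · intro h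
    exact absurd (Finset.mem_range.2 (by omega)) h

theorem form_ext {d : ℕ} {F G : Form 2 d} (h : ∀ j ≤ d, normCoeff F j = normCoeff G j) :
    F = G := by
  apply Subtype.ext
  rw [IsHomogeneous.eq_sum_range F.2, IsHomogeneous.eq_sum_range G.2]
  refine Finset.sum_congr rfl fun j hj => ?_
  have hj' : j ≤ d := by have := Finset.mem_range.1 hj; omega
  have hc : (d.choose j : ℂ) ≠ 0 := by exact_mod_cast (Nat.choose_pos hj').ne'
  have := h j hj'
  simp only [normCoeff, div_left_inj' hc] at this
  rw [this]

theorem form_ext_pairing {d : ℕ} {F G : Form 2 d}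
    (h : ∀ P : MvPolynomial (Fin 2) ℂ, P.IsHomogeneous d → pairing F P = pairing G P) : F = G :=
  form_ext fun j hj => by
    have := h (X 0 ^ (d - j) * X 1 ^ j)
      (by simpa [Nat.sub_add_cancel hj] using isHomogeneous_X_pow_mul_X_pow (d - j) j)
    rwa [pairing_X_pow_mul_X_pow F (by omega), pairing_X_pow_mul_X_pow G (by omega)] at this

/-- The linear form with given coefficients. -/
def linForm (z : Fin 2 → ℂ) : MvPolynomial (Fin 2) ℂ := z 0 • X 0 + z 1 • X 1

theorem isHomogeneous_linForm (z : Fin 2 → ℂ) : (linForm z).IsHomogeneous 1 :=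
  (homogeneousSubmodule (Fin 2) ℂ 1).add_mem
    (Submodule.smul_mem _ _ (isHomogeneous_X ℂ 0)) (Submodule.smul_mem _ _ (isHomogeneous_X ℂ 1))

theorem isHomogeneous_linForm_pow (z : Fin 2 → ℂ) (d : ℕ) :
    (linForm z ^ d).IsHomogeneous d := by
  simpa using (isHomogeneous_linForm z).pow d

theorem eval_linForm (z w : Fin 2 → ℂ) : eval w (linForm z) = z 0 * w 0 + z 1 * w 1 := by
  simp [linForm, smul_eval]

theorem linForm_smul (c : ℂ) (z : Fin 2 → ℂ) : linForm (c • z) = c • linForm z := by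
  simp [linForm, smul_add, mul_smul]

theorem linForm_eq_zero {z : Fin 2 → ℂ} (h : linForm z = 0) : z = 0 := by
  have h0 := congrArg (eval ![1, 0]) h
  have h1 := congrArg (eval ![0, 1]) h
  simp only [eval_linForm, map_zero] at h0 h1
  ext i; fin_cases i
  · simpa using h0
  · simpa using h1

theorem linForm_pow (z : Fin 2 → ℂ) (d : ℕ) : linForm z ^ d =
    ∑ j ∈ Finset.range (d + 1),
      (z 0 ^ (d - j) * z 1 ^ j * d.choose j) • (X 0 ^ (d - j) * X 1 ^ j) := by
  rw [linForm, add_comm, add_pow]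
  refine Finset.sum_congr rfl fun j hj => ?_
  simp only [smul_eq_C_mul, mul_pow, map_mul, map_pow, map_natCast]
  ring

theorem eval_eq_pairing {d : ℕ} (F : Form 2 d) (z : Fin 2 → ℂ) :
    eval z F.1 = pairing F (linForm z ^ d) := by
  rw [linForm_pow, map_sum]
  conv_lhs => rw [IsHomogeneous.eq_sum_range F.2, map_sum]
  refine Finset.sum_congr rfl fun j hj => ?_
  have hj' : j ≤ d := by have := Finset.mem_range.1 hj; omega
  have hc : (d.choose j : ℂ) ≠ 0 := by exact_mod_cast (Nat.choose_pos hj').ne'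
  rw [map_smul (pairing F), pairing_X_pow_mul_X_pow F (by omega), normCoeff]
  simp [smul_eval]
  field_simp

/-- Expanding `φ (linForm z ^ d)` by the binomial theorem as a polynomial in `z` recovers every `φ
(X 0 ^ a * X 1 ^ b)`. This identifies the apolar functional of the associated form with `ω`. -/
theorem pairing_eq_of_eval {d : ℕ} {F : Form 2 d} {φ : MvPolynomial (Fin 2) ℂ →ₗ[ℂ] ℂ}
    (h : ∀ z, eval z F.1 = φ (linForm z ^ d)) {P : MvPolynomial (Fin 2) ℂ}
    (hP : P.IsHomogeneous d) : pairing F P = φ P := by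
  refine hP.linearMap_ext fun a b hab => ?_
  rw [pairing_X_pow_mul_X_pow F hab]
  have hF : F.1 = ∑ j ∈ Finset.range (d + 1),
      (d.choose j * φ (X 0 ^ (d - j) * X 1 ^ j)) • (X 0 ^ (d - j) * X 1 ^ j) := by
    refine MvPolynomial.funext fun z => ?_
    rw [h, linForm_pow, map_sum, map_sum]
    refine Finset.sum_congr rfl fun j _ => ?_
    simp [smul_eval]
    ring
  have hc : (d.choose b : ℂ) ≠ 0 := by exact_mod_cast (Nat.choose_pos (by omega)).ne'
  rw [normCoeff, hF]
  simp only [coeff_sum, coeff_smul, coeff_X_pow_mul_X_pow]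
  rw [Finset.sum_eq_single b]
  · rw [if_pos ⟨rfl, rfl⟩, show d - b = a by omega, smul_eq_mul, mul_one]
    field_simp
  · intro j _ hj
    rw [if_neg fun h => hj h.2, smul_zero]
  · intro h
    exact absurd (Finset.mem_range.2 (by omega)) h

/-! ### Linear substitutions -/

/-- The substitution that replaces the `i`-th variable by the linear form with coefficients the
`i`-th row of `A`. -/
def lsub (A : Matrix (Fin 2) (Fin 2) ℂ) : MvPolynomial (Fin 2) ℂ →ₐ[ℂ] MvPolynomial (Fin 2) ℂ :=
  aeval fun i => linForm (A i)

theorem lsub_X (A : Matrix (Fin 2) (Fin 2) ℂ) (i : Fin 2) : lsub A (X i) = linForm (A i) := by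
  simp [lsub]

theorem lsub_linForm (A : Matrix (Fin 2) (Fin 2) ℂ) (z : Fin 2 → ℂ) :
    lsub A (linForm z) = linForm (Matrix.vecMul z A) := by
  simp only [linForm, map_add, map_smul, lsub_X, Matrix.vecMul, dotProduct, Fin.sum_univ_two]
  simp only [smul_add, add_smul, mul_smul]
  abel

theorem lsub_lsub (A B : Matrix (Fin 2) (Fin 2) ℂ) (P : MvPolynomial (Fin 2) ℂ) :
    lsub A (lsub B P) = lsub (B * A) P := by
  have : (lsub A).comp (lsub B) = lsub (B * A) := by
    ext1 i
    rw [AlgHom.comp_apply, lsub_X, lsub_X, lsub_linForm]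
    rfl
  exact DFunLike.congr_fun this P

theorem lsub_one (P : MvPolynomial (Fin 2) ℂ) : lsub 1 P = P := by
  have : lsub 1 = AlgHom.id ℂ _ := by
    ext1 i
    rw [lsub_X]
    fin_cases i <;> simp [linForm, Matrix.one_apply]
  rw [this, AlgHom.id_apply]

theorem isHomogeneous_lsub (A : Matrix (Fin 2) (Fin 2) ℂ) {d : ℕ} {P : MvPolynomial (Fin 2) ℂ}
    (hP : P.IsHomogeneous d) : (lsub A P).IsHomogeneous d := by
  have := hP.aeval (fun i => linForm (A i)) fun i => isHomogeneous_linForm _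
  rwa [one_mul] at this

theorem eval_lsub (A : Matrix (Fin 2) (Fin 2) ℂ) (z : Fin 2 → ℂ) (P : MvPolynomial (Fin 2) ℂ) :
    eval z (lsub A P) = eval (A.mulVec z) P := by
  have : (aeval z).comp (lsub A) = (aeval (A.mulVec z) : MvPolynomial (Fin 2) ℂ →ₐ[ℂ] ℂ) := by
    ext1 i
    have : aeval z (linForm (A i)) = A i 0 * z 0 + A i 1 * z 1 := eval_linForm _ _
    rw [AlgHom.comp_apply, lsub_X, aeval_X, this]
    simp [Matrix.mulVec, dotProduct, Fin.sum_univ_two]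
  simpa [coe_aeval_eq_eval] using DFunLike.congr_fun this P

theorem lsub_smul (c : ℂ) (A : Matrix (Fin 2) (Fin 2) ℂ) {d : ℕ} {P : MvPolynomial (Fin 2) ℂ}
    (hP : P.IsHomogeneous d) : lsub (c • A) P = c ^ d • lsub A P := by
  refine MvPolynomial.funext fun z => ?_
  rw [eval_lsub, Matrix.smul_mulVec, hP.eval_smul, smul_eval, eval_lsub]

/-- It suffices to test on powers of linear forms, where the pairing is evaluation; there the
substitution acts on the point by `A` and on the linear form by the transpose. -/
theorem pairing_lsub {d : ℕ} {F G : Form 2 d} {A : Matrix (Fin 2) (Fin 2) ℂ}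
    (h : G.1 = lsub A F.1) {P : MvPolynomial (Fin 2) ℂ} (hP : P.IsHomogeneous d) :
    pairing G P = pairing F (lsub A.transpose P) := by
  refine pairing_eq_of_eval (φ := pairing F ∘ₗ (lsub A.transpose).toLinearMap) (fun z => ?_) hP
  rw [h, eval_lsub, eval_eq_pairing, LinearMap.comp_apply, AlgHom.toLinearMap_apply,
    map_pow (lsub _), lsub_linForm, Matrix.vecMul_transpose]

theorem substPoly_eq_lsub (C : GL (Fin 2) ℂ) (Q : MvPolynomial (Fin 2) ℂ) :
    substPoly C Q = lsub (C⁻¹).1 Q := by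
  have : ∀ j, ∑ i, X i * MvPolynomial.C ((C⁻¹).1 j i) = linForm ((C⁻¹).1 j) := fun j => by
    simp only [linForm, Fin.sum_univ_two, smul_eq_C_mul, mul_comm]
  simp only [substPoly, this]
  rfl

theorem mem_glOrbit_iff_lsub {d : ℕ} {F G : Form 2 d} :
    G ∈ glOrbit F ↔ ∃ A : Matrix (Fin 2) (Fin 2) ℂ, A.det ≠ 0 ∧ G.1 = lsub A F.1 := by
  constructor
  · rintro ⟨C, rfl⟩
    exact ⟨(C⁻¹).1, (Matrix.isUnit_iff_isUnit_det _ |>.1 (C⁻¹).isUnit).ne_zero,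
      substPoly_eq_lsub C F.1⟩
  · rintro ⟨A, hA, h⟩
    refine ⟨(Matrix.GeneralLinearGroup.mkOfDetNeZero A hA)⁻¹, Subtype.ext ?_⟩
    rw [h]
    exact (substPoly_eq_lsub _ _).trans (by rw [inv_inv]; rfl)

theorem mem_glOrbit_iff_pairing {d : ℕ} {F G : Form 2 d} :
    G ∈ glOrbit F ↔ ∃ A : Matrix (Fin 2) (Fin 2) ℂ, A.det ≠ 0 ∧
      ∀ P : MvPolynomial (Fin 2) ℂ, P.IsHomogeneous d → pairing G P = pairing F (lsub A P) := by
  rw [mem_glOrbit_iff_lsub]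
  constructor
  · rintro ⟨A, hA, h⟩
    exact ⟨A.transpose, by rwa [Matrix.det_transpose], fun P hP => pairing_lsub h hP⟩
  · rintro ⟨A, hA, h⟩
    refine ⟨A.transpose, by rwa [Matrix.det_transpose], ?_⟩
    let G' : Form 2 d := ⟨lsub A.transpose F.1, isHomogeneous_lsub _ F.2⟩
    have : G = G' := form_ext_pairing fun P hP => by
      rw [h P hP, pairing_lsub (G := G') (F := F) rfl hP, Matrix.transpose_transpose]
    rw [this]

/-! ### The catalecticant -/

/-- The Hankel matrix whose determinant is the catalecticant. -/
def catMatrix {N : ℕ} (F : Form 2 (2 * N)) : Matrix (Fin (N + 1)) (Fin (N + 1)) ℂ :=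
  Matrix.of fun i j => normCoeff F (i.1 + j.1)

/-- The binary form with given coefficients. -/
def ofVec {N : ℕ} (c : Fin (N + 1) → ℂ) : MvPolynomial (Fin 2) ℂ :=
  ∑ j, c j • (X 0 ^ (N - j.1) * X 1 ^ j.1)

theorem isHomogeneous_ofVec {N : ℕ} (c : Fin (N + 1) → ℂ) : (ofVec c).IsHomogeneous N := by
  refine (homogeneousSubmodule (Fin 2) ℂ N).sum_mem fun j _ => Submodule.smul_mem _ _ ?_
  simpa [Nat.sub_add_cancel (Nat.lt_succ_iff.1 j.2)] using
    isHomogeneous_X_pow_mul_X_pow (N - j.1) j.1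

theorem exists_ofVec {N : ℕ} {P : MvPolynomial (Fin 2) ℂ} (hP : P.IsHomogeneous N) :
    ∃ c : Fin (N + 1) → ℂ, P = ofVec c :=
  ⟨fun j => coeff (Finsupp.single 0 (N - j.1) + Finsupp.single 1 j.1) P, by
    conv_lhs => rw [hP.eq_sum_range, Finset.sum_range]
    rfl⟩

theorem ofVec_eq_zero {N : ℕ} {c : Fin (N + 1) → ℂ} (h : ofVec c = 0) : c = 0 := by
  ext i
  have := congrArg (coeff (Finsupp.single 0 (N - i.1) + Finsupp.single 1 i.1)) h
  simp only [ofVec, coeff_sum, coeff_smul, coeff_X_pow_mul_X_pow, coeff_zero] at this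
  rw [Finset.sum_eq_single i] at this
  · simpa using this
  · intro j _ hj
    rw [if_neg fun h => hj (Fin.ext h.2), smul_zero]
  · simp

theorem pairing_ofVec_mul {N : ℕ} (F : Form 2 (2 * N)) (c : Fin (N + 1) → ℂ) (i : Fin (N + 1)) :
    pairing F (ofVec c * (X 0 ^ (N - i.1) * X 1 ^ i.1)) = (catMatrix F).mulVec c i := by
  simp only [ofVec, Finset.sum_mul, map_sum, smul_mul_assoc, map_smul, Matrix.mulVec, dotProduct]
  refine Finset.sum_congr rfl fun j _ => ?_
  have := i.2
  have := j.2
  rw [show (X 0 ^ (N - j.1) * X 1 ^ j.1 * (X 0 ^ (N - i.1) * X 1 ^ i.1) : MvPolynomial (Fin 2) ℂ)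
    = X 0 ^ ((N - j.1) + (N - i.1)) * X 1 ^ (i.1 + j.1) by ring,
    pairing_X_pow_mul_X_pow F (by omega), smul_eq_mul, mul_comm]
  rfl

/-- The catalecticant is non-zero if and only if the bilinear form `(P, R) ↦ ⟨F, P R⟩` on
forms of degree `N` is nondegenerate. -/
theorem mem_nonzeroCat_iff {N : ℕ} {F : Form 2 (2 * N)} :
    F ∈ nonzeroCat N ↔ ∀ P : MvPolynomial (Fin 2) ℂ, P.IsHomogeneous N →
      (∀ R : MvPolynomial (Fin 2) ℂ, R.IsHomogeneous N → pairing F (P * R) = 0) → P = 0 := by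
  change (catMatrix F).det ≠ 0 ↔ _
  constructor
  · intro h P hP hR
    obtain ⟨c, rfl⟩ := exists_ofVec hP
    by_contra hne
    refine h (Matrix.exists_mulVec_eq_zero_iff.1 ⟨c, ?_, ?_⟩)
    · rintro rfl
      exact hne (by simp [ofVec])
    · ext i
      rw [← pairing_ofVec_mul, Pi.zero_apply]
      refine hR _ ?_
      simpa [Nat.sub_add_cancel (Nat.lt_succ_iff.1 i.2)] using
        isHomogeneous_X_pow_mul_X_pow (N - i.1) i.1
  · intro h hdet
    obtain ⟨c, hc, hz⟩ := Matrix.exists_mulVec_eq_zero_iff.2 hdet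
    refine hc (ofVec_eq_zero (h _ (isHomogeneous_ofVec c) fun R hR => ?_))
    refine hR.linearMap_ext (φ := pairing F ∘ₗ LinearMap.mulLeft ℂ (ofVec c)) (ψ := 0)
      fun a b hab => ?_
    have := pairing_ofVec_mul F c ⟨b, by omega⟩
    rw [hz] at this
    simpa [← hab] using this

theorem ne_zero_of_mem_nonzeroCat {N : ℕ} {F : Form 2 (2 * N)} (hF : F ∈ nonzeroCat N) :
    F.1 ≠ 0 := by
  intro h
  refine pow_ne_zero N (X_ne_zero (R := ℂ) (0 : Fin 2))
    (mem_nonzeroCat_iff.1 hF _ (isHomogeneous_X_pow _ _) fun R _ => ?_)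
  simp [pairing, normCoeff, h]

theorem glOrbit_subset_nonzeroCat {N : ℕ} {F : Form 2 (2 * N)} (hF : F ∈ nonzeroCat N) :
    glOrbit F ⊆ nonzeroCat N := by
  intro G hG
  obtain ⟨A, hA, h⟩ := mem_glOrbit_iff_pairing.1 hG
  have hu : IsUnit A.det := hA.isUnit
  rw [mem_nonzeroCat_iff] at hF ⊢
  intro P hP hPR
  have : lsub A P = 0 := hF _ (isHomogeneous_lsub A hP) fun R hR => by
    have := hPR _ (isHomogeneous_lsub A⁻¹ hR)
    rwa [h _ (by simpa [two_mul] using hP.mul (isHomogeneous_lsub A⁻¹ hR)), map_mul, lsub_lsub,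
      Matrix.nonsing_inv_mul _ hu, lsub_one] at this
  rw [← lsub_one P, ← Matrix.mul_nonsing_inv _ hu, ← lsub_lsub, this, map_zero]

/-! ### Pairs of binary forms with non-zero resultant -/

/-- Dehomogenization `z₁ = t`, `z₂ = 1`. -/
def dehom : MvPolynomial (Fin 2) ℂ →ₐ[ℂ] Polynomial ℂ := aeval ![Polynomial.X, 1]

theorem dehom_X_pow_mul_X_pow (a b : ℕ) : dehom (X 0 ^ a * X 1 ^ b) = Polynomial.X ^ a := by
  simp [dehom]

theorem dehom_eq_sum {d : ℕ} {P : MvPolynomial (Fin 2) ℂ} (hP : P.IsHomogeneous d) :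
    dehom P = ∑ j ∈ Finset.range (d + 1),
      coeff (Finsupp.single 0 (d - j) + Finsupp.single 1 j) P • Polynomial.X ^ (d - j) := by
  conv_lhs => rw [hP.eq_sum_range, map_sum]
  simp only [map_smul, dehom_X_pow_mul_X_pow]

theorem natDegree_dehom_le {d : ℕ} {P : MvPolynomial (Fin 2) ℂ} (hP : P.IsHomogeneous d) :
    (dehom P).natDegree ≤ d := by
  rw [dehom_eq_sum hP]
  refine Polynomial.natDegree_sum_le_of_forall_le _ _ fun j _ => ?_
  exact (Polynomial.natDegree_smul_le _ _).trans (by simp)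

theorem dehom_injOn {d : ℕ} {P : MvPolynomial (Fin 2) ℂ} (hP : P.IsHomogeneous d)
    (h : dehom P = 0) : P = 0 := by
  rw [hP.eq_sum_range]
  refine Finset.sum_eq_zero fun j hj => ?_
  have hj' := Finset.mem_range.1 hj
  have := congrArg (fun p => Polynomial.coeff p (d - j)) h
  rw [dehom_eq_sum hP] at this
  simp only [Polynomial.finsetSum_coeff, Polynomial.coeff_smul, Polynomial.coeff_X_pow,
    Polynomial.coeff_zero] at this
  rw [Finset.sum_eq_single j] at this
  · rw [if_pos rfl, smul_eq_mul, mul_one] at this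
    rw [this, zero_smul]
  · intro i hi hij
    have := Finset.mem_range.1 hi
    rw [if_neg (by omega), smul_zero]
  · exact fun h => absurd hj h

theorem exists_dehom_eq {d : ℕ} {p : Polynomial ℂ} (hp : p.natDegree ≤ d) :
    ∃ P : MvPolynomial (Fin 2) ℂ, P.IsHomogeneous d ∧ dehom P = p := by
  refine ⟨∑ j ∈ Finset.range (d + 1), p.coeff j • (X 0 ^ j * X 1 ^ (d - j)),
    (homogeneousSubmodule (Fin 2) ℂ d).sum_mem fun j hj => Submodule.smul_mem _ _ ?_, ?_⟩
  · have := Finset.mem_range.1 hj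
    simpa [show j + (d - j) = d by omega] using isHomogeneous_X_pow_mul_X_pow j (d - j)
  · simp only [map_sum, map_smul, dehom_X_pow_mul_X_pow]
    conv_rhs => rw [p.as_sum_range' (d + 1) (by omega)]
    simp only [← Polynomial.C_mul_X_pow_eq_monomial, Polynomial.smul_eq_C_mul]

/-- If the resultant of two binary forms of degree `k` is non-zero, then the ideal that they
generate contains all forms of degree `2 k - 1`. -/
theorem mem_span_pair_of_resultant_ne_zero {k d : ℕ} (hkd : k + k = d + 1)
    {f g : MvPolynomial (Fin 2) ℂ} (hf : f.IsHomogeneous k) (hg : g.IsHomogeneous k)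
    (hr : Polynomial.resultant (dehom f) (dehom g) k k ≠ 0)
    {P : MvPolynomial (Fin 2) ℂ} (hP : P.IsHomogeneous d) : P ∈ Ideal.span {f, g} := by
  have hk : 0 < k := by omega
  have hPdeg : dehom P ∈ Polynomial.degreeLT ℂ (k + k) :=
    Polynomial.mem_degreeLT.2 <| (Polynomial.degree_le_of_natDegree_le
      (natDegree_dehom_le hP)).trans_lt (by exact_mod_cast (by omega : d < k + k))
  -- The adjugate of the Sylvester map supplies Bézout cofactors of degree `< k` for the resultant
  -- times `dehom P`; they are then homogenized to degree `k - 1`.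
  set v := Polynomial.adjSylvester (m := k) (n := k) (dehom f) (dehom g) ⟨dehom P, hPdeg⟩ with hv
  have key := congrArg Subtype.val (LinearMap.congr_fun (Polynomial.sylveserMap_comp_adjSylvester
    (dehom f) (dehom g) (natDegree_dehom_le hf) (natDegree_dehom_le hg)) ⟨dehom P, hPdeg⟩)
  rw [LinearMap.comp_apply, ← hv] at key
  have hdeg : ∀ w : Polynomial.degreeLT ℂ k, w.1.natDegree ≤ k - 1 := fun w => by
    have := Polynomial.mem_degreeLT.1 w.2
    rcases eq_or_ne w.1 0 with h0 | h0
    · simp [h0]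
    · have := (Polynomial.natDegree_lt_iff_degree_lt h0).2 this
      omega
  obtain ⟨A, hA, hA'⟩ := exists_dehom_eq (hdeg v.2)
  obtain ⟨B, hB, hB'⟩ := exists_dehom_eq (hdeg v.1)
  have e : k + (k - 1) = d := by omega
  set r := Polynomial.resultant (dehom f) (dehom g) k k
  have hhom : (f * A + g * B - r • P).IsHomogeneous d :=
    ((e ▸ hf.mul hA).add (e ▸ hg.mul hB)).sub
      ((homogeneousSubmodule (Fin 2) ℂ d).smul_mem r hP)
  have h0 : f * A + g * B - r • P = 0 := dehom_injOn hhom <| by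
    rw [map_sub, map_add, map_mul, map_mul, map_smul, hA', hB', sub_eq_zero]
    exact key
  have h1 : P = C r⁻¹ * (f * A + g * B) := by
    rw [sub_eq_zero.1 h0, smul_eq_C_mul, ← mul_assoc, ← C_mul, inv_mul_cancel₀ hr, C_1, one_mul]
  rw [h1]
  refine Ideal.mul_mem_left _ _ (Ideal.mem_span_pair.2 ⟨A, B, by ring⟩)

/-- A common divisor divides both `X 0 ^ d` and `X 1 ^ d`, and these have only units in common. -/
theorem isRelPrime_of_forall_mem_span {d : ℕ} {f g : MvPolynomial (Fin 2) ℂ}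
    (h : ∀ P : MvPolynomial (Fin 2) ℂ, P.IsHomogeneous d → P ∈ Ideal.span {f, g}) :
    IsRelPrime f g := by
  intro q hqf hqg
  have hq : ∀ i, q ∣ X i ^ d := fun i => by
    obtain ⟨a, b, hab⟩ := Ideal.mem_span_pair.1 (h _ (isHomogeneous_X_pow i d))
    exact hab ▸ dvd_add (hqf.mul_left a) (hqg.mul_left b)
  obtain ⟨i, -, hi⟩ := (dvd_prime_pow X_prime d).1 (hq 0)
  rcases Nat.eq_zero_or_pos i with rfl | hpos
  · simpa [associated_one_iff_isUnit] using hi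
  · have h1 : (X 0 : MvPolynomial (Fin 2) ℂ) ∣ X 1 ^ d :=
      ((dvd_pow_self _ hpos.ne').trans hi.symm.dvd).trans (hq 1)
    exact absurd (X_dvd_X.1 (X_prime.dvd_of_dvd_pow h1)) (by decide)

/-- Syzygies of a pair of coprime elements. -/
theorem exists_of_mul_add_mul_eq_zero {f g A B : MvPolynomial (Fin 2) ℂ} (hf : f ≠ 0)
    (hfg : IsRelPrime f g) (h : A * f + B * g = 0) : ∃ s, A = g * s ∧ B = -(f * s) := by
  obtain ⟨t, ht⟩ : f ∣ B := hfg.dvd_of_dvd_mul_left (y := g)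
    ⟨-A, by linear_combination h⟩
  refine ⟨-t, ?_, by rw [ht]; ring⟩
  have : f * (A - g * -t) = 0 := by
    rw [ht] at h
    linear_combination h
  exact sub_eq_zero.1 ((mul_eq_zero.1 this).resolve_left hf)

theorem exists_of_X_mul_eq_X_mul {U V : MvPolynomial (Fin 2) ℂ} (h : X 1 * U = X 0 * V) :
    ∃ u, U = X 0 * u ∧ V = X 1 * u := by
  have h01 : ¬ (X 0 : MvPolynomial (Fin 2) ℂ) ∣ X 1 := by
    rw [X_dvd_X]; decide
  obtain ⟨u, rfl⟩ := (X_prime.dvd_or_dvd (Dvd.intro V h.symm)).resolve_left h01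
  refine ⟨u, rfl, mul_left_cancel₀ (X_ne_zero (R := ℂ) (0 : Fin 2)) ?_⟩
  rw [← h]
  ring

theorem mem_idealOfVars_iff {P : MvPolynomial (Fin 2) ℂ} :
    P ∈ idealOfVars (Fin 2) ℂ ↔ constantCoeff P = 0 := by
  rw [← pow_one (idealOfVars (Fin 2) ℂ), mem_pow_idealOfVars_iff']
  constructor
  · intro h
    exact h 0 (by simp)
  · intro h s hs
    have : s = 0 := (Finsupp.degree_eq_zero_iff s).1 (by omega)
    rw [this]
    exact h

theorem mem_idealOfVars_mul_mem {I : Ideal (MvPolynomial (Fin 2) ℂ)} {P R : MvPolynomial (Fin 2) ℂ}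
    (h : ∀ i, X i * P ∈ I) (hR : constantCoeff R = 0) : R * P ∈ I := by
  have hR' := mem_idealOfVars_iff.2 hR
  induction hR' using Submodule.span_induction with
  | mem x hx =>
    obtain ⟨i, rfl⟩ := hx
    exact h i
  | zero => simp
  | add x y hx hy ihx ihy =>
    rw [add_mul]
    exact I.add_mem (ihx (mem_idealOfVars_iff.1 hx)) (ihy (mem_idealOfVars_iff.1 hy))
  | smul a x hx ih =>
    rw [smul_eq_mul, mul_assoc]
    exact I.mul_mem_left _ (ih (mem_idealOfVars_iff.1 hx))

/-! ### The socle of the quotient by a coprime pair: the determinant of Euler cofactors -/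

section Socle

variable {f g f₀ f₁ g₀ g₁ : MvPolynomial (Fin 2) ℂ} {c : ℂ}

/-- Cramer's rule for the system expressing `c f`, `c g` through the variables. With `f`, `g` the
partials of `Q`, Euler's formula provides the cofactors and the determinant is the Hessian. -/
theorem X_mul_det_mem (hf : X 0 * f₀ + X 1 * f₁ = C c * f) (hg : X 0 * g₀ + X 1 * g₁ = C c * g)
    (i : Fin 2) : X i * (f₀ * g₁ - g₀ * f₁) ∈ Ideal.span {f, g} := by
  revert i
  refine Fin.forall_fin_two.2 ⟨?_, ?_⟩
  · exact Ideal.mem_span_pair.2 ⟨C c * g₁, -(C c * f₁), by linear_combination f₁ * hg - g₁ * hf⟩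
  · exact Ideal.mem_span_pair.2 ⟨-(C c * g₀), C c * f₀, by linear_combination g₀ * hf - f₀ * hg⟩

/-- Comparing a hypothetical expression `A f + B g` of the determinant with Cramer's rule gives two
syzygies, both multiples of the Koszul one. Eliminating `A` yields `c² = X 0 * r - X 1 * s`, which
fails at the origin. -/
theorem det_notMem (hf : X 0 * f₀ + X 1 * f₁ = C c * f)
    (hg : X 0 * g₀ + X 1 * g₁ = C c * g) (hc : c ≠ 0) (hf0 : f ≠ 0) (hfg : IsRelPrime f g)
    (hg0 : g ≠ 0) : f₀ * g₁ - g₀ * f₁ ∉ Ideal.span {f, g} := by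
  intro hmem
  obtain ⟨A, B, hAB⟩ := Ideal.mem_span_pair.1 hmem
  obtain ⟨s, hs, -⟩ := exists_of_mul_add_mul_eq_zero (A := X 0 * A - C c * g₁)
    (B := X 0 * B + C c * f₁) hf0 hfg
    (by linear_combination X 0 * hAB + g₁ * hf - f₁ * hg)
  obtain ⟨r, hr, -⟩ := exists_of_mul_add_mul_eq_zero (A := X 1 * A + C c * g₀)
    (B := X 1 * B - C c * f₀) hf0 hfg
    (by linear_combination X 1 * hAB + f₀ * hg - g₀ * hf)
  have h1 : g * (C (c * c) - (X 0 * r - X 1 * s)) = 0 := by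
    rw [C_mul]
    linear_combination X 0 * hr - X 1 * hs - C c * hg
  have h2 := congrArg constantCoeff
    (sub_eq_zero.1 ((mul_eq_zero.1 h1).resolve_left hg0))
  simp [hc] at h2

/-- Writing `X 0 * P` and `X 1 * P` in terms of `f`, `g` and cancelling gives a syzygy, hence a
Koszul multiplier `h`. Then `c² P` is `h` times the determinant modulo the ideal, and only the
constant term of `h` matters, since the variables push the determinant into the ideal. -/
theorem exists_sub_smul_det_mem (hf : X 0 * f₀ + X 1 * f₁ = C c * f)
    (hg : X 0 * g₀ + X 1 * g₁ = C c * g) (hc : c ≠ 0) (hf0 : f ≠ 0) (hfg : IsRelPrime f g)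
    {P : MvPolynomial (Fin 2) ℂ}
    (hP : ∀ i, X i * P ∈ Ideal.span {f, g}) :
    ∃ a : ℂ, P - a • (f₀ * g₁ - g₀ * f₁) ∈ Ideal.span {f, g} := by
  obtain ⟨A, B, hAB⟩ := Ideal.mem_span_pair.1 (hP 0)
  obtain ⟨A', B', hAB'⟩ := Ideal.mem_span_pair.1 (hP 1)
  obtain ⟨h, h1, h2⟩ := exists_of_mul_add_mul_eq_zero (A := X 1 * A - X 0 * A')
    (B := X 1 * B - X 0 * B') hf0 hfg (by linear_combination X 1 * hAB - X 0 * hAB')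
  obtain ⟨u, hu, -⟩ := exists_of_X_mul_eq_X_mul (U := C c * A - h * g₁) (V := C c * A' + h * g₀)
    (by linear_combination C c * h1 - h * hg)
  obtain ⟨v, hv, -⟩ := exists_of_X_mul_eq_X_mul (U := C c * B + h * f₁) (V := C c * B' - h * f₀)
    (by linear_combination C c * h2 + h * hf)
  have h3 : C c * (C c * P) = h * (f₀ * g₁ - g₀ * f₁) + C c * (u * f + v * g) :=
    mul_left_cancel₀ (X_ne_zero (R := ℂ) (0 : Fin 2)) <| by
      linear_combination C c * f * hu + C c * g * hv - C c * C c * hAB - h * g₁ * hf + h * f₁ * hg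
  refine ⟨c⁻¹ * c⁻¹ * constantCoeff h, ?_⟩
  have hcc : (C c⁻¹ * C c : MvPolynomial (Fin 2) ℂ) = 1 := by
    rw [← C_mul, inv_mul_cancel₀ hc, C_1]
  have h4 : P - (c⁻¹ * c⁻¹ * constantCoeff h) • (f₀ * g₁ - g₀ * f₁) =
      C c⁻¹ * C c⁻¹ * ((h - C (constantCoeff h)) * (f₀ * g₁ - g₀ * f₁)) +
        C c⁻¹ * (u * f + v * g) := by
    rw [smul_eq_C_mul, C_mul, C_mul]
    linear_combination C c⁻¹ * C c⁻¹ * h3 -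
      (P * (C c⁻¹ * C c + 1) - C c⁻¹ * (u * f + v * g)) * hcc
  rw [h4]
  refine Ideal.add_mem _ (Ideal.mul_mem_left _ _ (mem_idealOfVars_mul_mem
    (X_mul_det_mem hf hg) (by simp))) (Ideal.mul_mem_left _ _ (Ideal.mem_span_pair.2 ⟨u, v, rfl⟩))

end Socle

/-! ### The Milnor algebra of a nondegenerate binary form -/

theorem jacobianIdeal_eq_span_pair (Q : MvPolynomial (Fin 2) ℂ) :
    jacobianIdeal Q = Ideal.span {pderiv 0 Q, pderiv 1 Q} := by
  rw [jacobianIdeal]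
  congr 1
  ext P
  simp [Fin.exists_fin_two, eq_comm]

theorem hessian_eq (Q : MvPolynomial (Fin 2) ℂ) :
    hessian Q = pderiv 0 (pderiv 0 Q) * pderiv 1 (pderiv 1 Q) -
      pderiv 0 (pderiv 1 Q) * pderiv 1 (pderiv 0 Q) := by
  simp [hessian, Matrix.det_fin_two]

theorem euler_fin_two {d : ℕ} {P : MvPolynomial (Fin 2) ℂ} (hP : P.IsHomogeneous d) :
    X 0 * pderiv 0 P + X 1 * pderiv 1 P = C (d : ℂ) * P := by
  have := hP.sum_X_mul_pderiv
  rwa [Fin.sum_univ_two, nsmul_eq_mul, ← map_natCast C] at this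

section Nondegenerate

variable {m : ℕ} {Q : Form 2 m}

theorem mem_jacobianIdeal_of_isHomogeneous (hm : 3 ≤ m) (hQ : Q ∈ nondegenerateForms m)
    {P : MvPolynomial (Fin 2) ℂ}
    (hP : P.IsHomogeneous (2 * (m - 2) + 1)) : P ∈ jacobianIdeal Q.1 := by
  rw [jacobianIdeal_eq_span_pair]
  exact mem_span_pair_of_resultant_ne_zero (k := m - 1) (by omega) (IsHomogeneous.pderiv Q.2)
    (IsHomogeneous.pderiv Q.2) hQ hP

theorem isRelPrime_pderiv (hm : 3 ≤ m) (hQ : Q ∈ nondegenerateForms m) :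
    IsRelPrime (pderiv 0 Q.1) (pderiv 1 Q.1) :=
  isRelPrime_of_forall_mem_span (d := 2 * (m - 2) + 1) fun P hP => by
    rw [← jacobianIdeal_eq_span_pair]
    exact mem_jacobianIdeal_of_isHomogeneous hm hQ hP

theorem not_isUnit_pderiv (hm : 3 ≤ m) (i : Fin 2) : ¬ IsUnit (pderiv i Q.1) := by
  intro h
  have h1 : (pderiv i Q.1).IsHomogeneous (m - 1) := IsHomogeneous.pderiv Q.2
  have h2 : constantCoeff (pderiv i Q.1) = 0 := h1.coeff_eq_zero (by simp; omega)
  have := h.map constantCoeff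
  rw [h2] at this
  exact not_isUnit_zero this

theorem pderiv_zero_ne_zero (hm : 3 ≤ m) (hQ : Q ∈ nondegenerateForms m) :
    pderiv 0 Q.1 ≠ 0 := fun h => by
  have := isRelPrime_pderiv hm hQ
  rw [h, isRelPrime_zero_left] at this
  exact not_isUnit_pderiv hm 1 this

theorem pderiv_one_ne_zero (hm : 3 ≤ m) (hQ : Q ∈ nondegenerateForms m) :
    pderiv 1 Q.1 ≠ 0 := fun h => by
  have := isRelPrime_pderiv hm hQ
  rw [h, isRelPrime_zero_right] at this
  exact not_isUnit_pderiv hm 0 this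

theorem natCast_pred_ne_zero (hm : 3 ≤ m) :
    ((m - 1 : ℕ) : ℂ) ≠ 0 := by
  exact_mod_cast (by omega : m - 1 ≠ 0)

theorem hessian_notMem (hm : 3 ≤ m) (hQ : Q ∈ nondegenerateForms m) :
    hessian Q.1 ∉ jacobianIdeal Q.1 := by
  rw [jacobianIdeal_eq_span_pair, hessian_eq]
  exact det_notMem (euler_fin_two (IsHomogeneous.pderiv Q.2))
    (euler_fin_two (IsHomogeneous.pderiv Q.2)) (natCast_pred_ne_zero hm)
    (pderiv_zero_ne_zero hm hQ) (isRelPrime_pderiv hm hQ) (pderiv_one_ne_zero hm hQ)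

theorem exists_sub_smul_hessian_mem (hm : 3 ≤ m) (hQ : Q ∈ nondegenerateForms m)
    {P : MvPolynomial (Fin 2) ℂ}
    (hP : ∀ i, X i * P ∈ jacobianIdeal Q.1) :
    ∃ a : ℂ, P - a • hessian Q.1 ∈ jacobianIdeal Q.1 := by
  rw [jacobianIdeal_eq_span_pair] at hP ⊢
  rw [hessian_eq]
  exact exists_sub_smul_det_mem (euler_fin_two (IsHomogeneous.pderiv Q.2))
    (euler_fin_two (IsHomogeneous.pderiv Q.2)) (natCast_pred_ne_zero hm)
    (pderiv_zero_ne_zero hm hQ) (isRelPrime_pderiv hm hQ) hP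

theorem isHomogeneous_hessian : (hessian Q.1).IsHomogeneous (2 * (m - 2)) := by
  have h : ∀ i j, (pderiv i (pderiv j Q.1)).IsHomogeneous (m - 2) := fun i j => by
    have : (pderiv j Q.1).IsHomogeneous (m - 1) := IsHomogeneous.pderiv Q.2
    exact this.pderiv
  rw [hessian_eq, two_mul]
  exact ((h _ _).mul (h _ _)).sub ((h _ _).mul (h _ _))

end Nondegenerate

/-! ### The socle -/

theorem cls_mem_maxIdeal {n : ℕ} (Q : MvPolynomial (Fin n) ℂ) {P : MvPolynomial (Fin n) ℂ}
    (hP : constantCoeff P = 0) : cls Q P ∈ maxIdeal Q :=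
  Ideal.mem_map_of_mem _ hP

theorem cls_eq_zero_iff {n : ℕ} {Q P : MvPolynomial (Fin n) ℂ} :
    cls Q P = 0 ↔ P ∈ jacobianIdeal Q := Ideal.Quotient.eq_zero_iff_mem

theorem cls_mem_socle {Q P : MvPolynomial (Fin 2) ℂ} (hP : constantCoeff P = 0)
    (hX : ∀ i, X i * P ∈ jacobianIdeal Q) : cls Q P ∈ socle Q := by
  refine ⟨cls_mem_maxIdeal Q hP, fun y hy => ?_⟩
  obtain ⟨R, hR, rfl⟩ :=
    (Ideal.mem_map_iff_of_surjective _ Ideal.Quotient.mk_surjective).1 hy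
  rw [cls, ← map_mul, mul_comm]
  exact Ideal.Quotient.eq_zero_iff_mem.2 (mem_idealOfVars_mul_mem hX hR)

theorem X_mul_mem_of_cls_mem_socle {n : ℕ} {Q P : MvPolynomial (Fin n) ℂ} (h : cls Q P ∈ socle Q)
    (i : Fin n) : X i * P ∈ jacobianIdeal Q := by
  have := h.2 _ (cls_mem_maxIdeal Q (constantCoeff_X (R := ℂ) i))
  rw [cls, cls, ← map_mul, mul_comm] at this
  exact Ideal.Quotient.eq_zero_iff_mem.1 this

/-- The class of a polynomial in the Milnor algebra, as a linear map. -/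
def clsₗ {n : ℕ} (Q : MvPolynomial (Fin n) ℂ) : MvPolynomial (Fin n) ℂ →ₗ[ℂ] Milnor Q :=
  (Ideal.Quotient.mkₐ ℂ (jacobianIdeal Q)).toLinearMap

theorem clsₗ_apply {n : ℕ} (Q P : MvPolynomial (Fin n) ℂ) : clsₗ Q P = cls Q P := rfl

theorem sum_smul_cls_pow (Q : MvPolynomial (Fin 2) ℂ) (z : Fin 2 → ℂ) (d : ℕ) :
    (∑ j, z j • cls Q (X j)) ^ d = cls Q (linForm z ^ d) := by
  simp only [← clsₗ_apply, ← map_smul, ← map_sum, Fin.sum_univ_two]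
  exact (map_pow (Ideal.Quotient.mk (jacobianIdeal Q)) _ _).symm

theorem exists_form_of_functional (φ : MvPolynomial (Fin 2) ℂ →ₗ[ℂ] ℂ) (d : ℕ) :
    ∃ F : Form 2 d, ∀ z, eval z F.1 = φ (linForm z ^ d) := by
  refine ⟨⟨∑ j ∈ Finset.range (d + 1),
      (d.choose j * φ (X 0 ^ (d - j) * X 1 ^ j)) • (X 0 ^ (d - j) * X 1 ^ j),
    (homogeneousSubmodule (Fin 2) ℂ d).sum_mem fun j hj => Submodule.smul_mem _ _ ?_⟩,
    fun z => ?_⟩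
  · have := Finset.mem_range.1 hj
    simpa [show d - j + j = d by omega] using isHomogeneous_X_pow_mul_X_pow (d - j) j
  · rw [linForm_pow, map_sum, map_sum]
    refine Finset.sum_congr rfl fun j _ => ?_
    simp [smul_eval]
    ring

section Nondegenerate

variable {m : ℕ} {Q : Form 2 m}

theorem constantCoeff_eq_zero_of_isHomogeneous (hm : 3 ≤ m) {P : MvPolynomial (Fin 2) ℂ}
    (hP : P.IsHomogeneous (2 * (m - 2))) : constantCoeff P = 0 :=
  hP.coeff_eq_zero (by simp; omega)

theorem cls_mem_socle_of_isHomogeneous (hm : 3 ≤ m) (hQ : Q ∈ nondegenerateForms m)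
    {P : MvPolynomial (Fin 2) ℂ}
    (hP : P.IsHomogeneous (2 * (m - 2))) : cls Q.1 P ∈ socle Q.1 :=
  cls_mem_socle (constantCoeff_eq_zero_of_isHomogeneous hm hP) fun i =>
    mem_jacobianIdeal_of_isHomogeneous hm hQ <| by
      simpa [add_comm] using (isHomogeneous_X ℂ i).mul hP

theorem exists_isAssociatedForm (hm : 3 ≤ m) (hQ : Q ∈ nondegenerateForms m) :
    ∃ F, IsAssociatedForm Q F := by
  have hH : cls Q.1 (hessian Q.1) ∈ socle Q.1 :=
    cls_mem_socle_of_isHomogeneous hm hQ isHomogeneous_hessian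
  have hbij : Function.Bijective (LinearMap.toSpanSingleton ℂ (socle Q.1) ⟨_, hH⟩) := by
    constructor
    · rw [← LinearMap.ker_eq_bot, LinearMap.ker_toSpanSingleton]
      intro h
      exact hessian_notMem hm hQ (cls_eq_zero_iff.1 (congrArg Subtype.val h))
    · rintro ⟨x, hx⟩
      obtain ⟨P, rfl⟩ := Ideal.Quotient.mk_surjective x
      obtain ⟨a, ha⟩ := exists_sub_smul_hessian_mem hm hQ (X_mul_mem_of_cls_mem_socle hx)
      refine ⟨a, Subtype.ext ?_⟩
      have := cls_eq_zero_iff.2 ha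
      rw [← clsₗ_apply, map_sub, map_smul, sub_eq_zero] at this
      exact this.symm
  let ω : socle Q.1 ≃ₗ[ℂ] ℂ := (LinearEquiv.ofBijective _ hbij).symm
  -- `ω` lives on the socle only. Any linear extension to the Milnor algebra serves, since it is
  -- evaluated only on classes of forms of degree `2 * (m - 2)`, which lie in the socle.
  obtain ⟨ψ, hψ⟩ := LinearMap.exists_extend ω.toLinearMap
  obtain ⟨F, hF⟩ := exists_form_of_functional (ψ ∘ₗ clsₗ Q.1) (2 * (m - 2))
  refine ⟨F, ω, ⟨hH, ?_⟩, fun z => ?_⟩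
  · rw [LinearEquiv.symm_apply_eq]
    simp
  · have h := cls_mem_socle_of_isHomogeneous hm hQ (isHomogeneous_linForm_pow z _)
    rw [sum_smul_cls_pow]
    refine ⟨h, ?_⟩
    rw [hF]
    exact LinearMap.congr_fun hψ ⟨_, h⟩

theorem isAssociatedForm_associatedForm (hm : 3 ≤ m) (hQ : Q ∈ nondegenerateForms m) :
    IsAssociatedForm Q (associatedForm Q) := by
  have h := exists_isAssociatedForm hm hQ
  rw [associatedForm, dif_pos h]
  exact h.choose_spec

/-- A form of top degree is orthogonal to the associated form if and only if it lies in the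
Jacobian ideal. -/
theorem pairing_associatedForm_eq_zero_iff (hm : 3 ≤ m) (hQ : Q ∈ nondegenerateForms m)
    {P : MvPolynomial (Fin 2) ℂ}
    (hP : P.IsHomogeneous (2 * (m - 2))) :
    pairing (associatedForm Q) P = 0 ↔ P ∈ jacobianIdeal Q.1 := by
  obtain ⟨ω, -, hω⟩ := isAssociatedForm_associatedForm hm hQ
  obtain ⟨ψ, hψ⟩ := LinearMap.exists_extend ω.toLinearMap
  have hψ' : ∀ x : socle Q.1, ψ x.1 = ω x := fun x => LinearMap.congr_fun hψ x
  have key : pairing (associatedForm Q) P = ψ (cls Q.1 P) := by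
    refine pairing_eq_of_eval (φ := ψ ∘ₗ clsₗ Q.1) (fun z => ?_) hP
    obtain ⟨h, hz⟩ := hω z
    rw [hz, ← hψ' ⟨_, h⟩]
    exact congrArg ψ (sum_smul_cls_pow _ _ _)
  rw [key, hψ' ⟨_, cls_mem_socle_of_isHomogeneous hm hQ hP⟩, LinearEquiv.map_eq_zero_iff,
    ← cls_eq_zero_iff]
  exact Subtype.ext_iff

theorem lsub_smul_one_mem_jacobianIdeal {P : MvPolynomial (Fin 2) ℂ} (c : ℂ)
    (hP : P ∈ jacobianIdeal Q.1) : lsub (c • 1) P ∈ jacobianIdeal Q.1 := by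
  rw [jacobianIdeal_eq_span_pair] at hP ⊢
  obtain ⟨A, B, rfl⟩ := Ideal.mem_span_pair.1 hP
  rw [map_add, map_mul, map_mul,
    lsub_smul c 1 (IsHomogeneous.pderiv Q.2 : (pderiv 0 Q.1).IsHomogeneous _),
    lsub_smul c 1 (IsHomogeneous.pderiv Q.2 : (pderiv 1 Q.1).IsHomogeneous _), lsub_one, lsub_one]
  exact Ideal.mem_span_pair.2 ⟨c ^ (m - 1) • lsub (c • 1) A, c ^ (m - 1) • lsub (c • 1) B, by
    simp only [smul_mul_assoc, mul_smul_comm]⟩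

/-- Apolarity: a form that is annihilated by the associated form lies in the Jacobian ideal. -/
theorem mem_jacobianIdeal_of_pairing_eq_zero (hm : 3 ≤ m) (hQ : Q ∈ nondegenerateForms m)
    {d e : ℕ} (hde : d + e = 2 * (m - 2))
    {P : MvPolynomial (Fin 2) ℂ} (hP : P.IsHomogeneous d)
    (h : ∀ R : MvPolynomial (Fin 2) ℂ, R.IsHomogeneous e →
      pairing (associatedForm Q) (P * R) = 0) : P ∈ jacobianIdeal Q.1 := by
  induction e generalizing d P with
  | zero =>
    have := h 1 (isHomogeneous_one _ _)
    rw [mul_one] at this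
    rw [add_zero] at hde
    exact (pairing_associatedForm_eq_zero_iff hm hQ (hde ▸ hP)).1 this
  | succ e ih =>
    -- By induction `X i * P` lies in the ideal, so `P` is a multiple of the Hessian modulo the
    -- ideal. As `d < 2 * (m - 2)`, the two have different degrees, and scaling the variables by
    -- `2`, which preserves the ideal, separates them.
    obtain ⟨a, ha⟩ := exists_sub_smul_hessian_mem hm hQ (P := P) fun i =>
      ih (d := d + 1) (by omega) (hP := by simpa [add_comm] using (isHomogeneous_X ℂ i).mul hP)
      fun R hR => by
        have := h (X i * R) (by simpa [add_comm] using (isHomogeneous_X ℂ i).mul hR)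
        rwa [← mul_assoc, mul_comm P] at this
    have h1 := lsub_smul_one_mem_jacobianIdeal 2 ha
    rw [map_sub, map_smul, lsub_smul _ _ hP, lsub_smul _ _ isHomogeneous_hessian, lsub_one,
      lsub_one] at h1
    have h2 := Ideal.sub_mem _ h1 (Submodule.smul_of_tower_mem _ ((2 : ℂ) ^ (2 * (m - 2))) ha)
    have h3 : (2 : ℂ) ^ d • P - a • (2 : ℂ) ^ (2 * (m - 2)) • hessian Q.1 -
        (2 : ℂ) ^ (2 * (m - 2)) • (P - a • hessian Q.1) =
        ((2 : ℂ) ^ d - (2 : ℂ) ^ (2 * (m - 2))) • P := by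
      simp only [smul_sub, sub_smul, smul_smul, mul_comm a]
      abel
    rw [h3] at h2
    have h4 : (2 : ℂ) ^ d - (2 : ℂ) ^ (2 * (m - 2)) ≠ 0 := by
      rw [sub_ne_zero]
      exact_mod_cast (Nat.pow_right_injective le_rfl).ne (by omega : d ≠ 2 * (m - 2))
    have h5 := Submodule.smul_of_tower_mem _ ((2 : ℂ) ^ d - (2 : ℂ) ^ (2 * (m - 2)))⁻¹ h2
    rwa [smul_smul, inv_mul_cancel₀ h4, one_smul] at h5

theorem jacobianIdeal_le_pow : jacobianIdeal Q.1 ≤ idealOfVars (Fin 2) ℂ ^ (m - 1) := by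
  rw [jacobianIdeal, Ideal.span_le]
  rintro _ ⟨i, rfl⟩
  rw [SetLike.mem_coe, mem_pow_idealOfVars_iff']
  intro s hs
  exact (IsHomogeneous.pderiv Q.2 : (pderiv i Q.1).IsHomogeneous (m - 1)).coeff_eq_zero (by omega)

/-- A kernel vector of the catalecticant pairing is a form of degree `m - 2` in the Jacobian ideal,
whose elements have order at least `m - 1`. -/
theorem associatedForm_mem_nonzeroCat (hm : 3 ≤ m) (hQ : Q ∈ nondegenerateForms m) :
    associatedForm Q ∈ nonzeroCat (m - 2) := by
  rw [mem_nonzeroCat_iff]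
  intro P hP h
  have hmem := mem_jacobianIdeal_of_pairing_eq_zero hm hQ (by omega) hP h
  have h1 := (mem_pow_idealOfVars_iff' _ _).1 (jacobianIdeal_le_pow hmem)
  ext s
  by_cases hs : s.degree = m - 2
  · exact h1 s (by omega)
  · exact hP.coeff_eq_zero hs

/-- The forms of degree `m - 1` that are apolar to the associated form are the linear combinations
of the partial derivatives. -/
theorem exists_eq_smul_pderiv_add_smul_pderiv (hm : 3 ≤ m) (hQ : Q ∈ nondegenerateForms m)
    {P : MvPolynomial (Fin 2) ℂ}
    (hP : P.IsHomogeneous (m - 1)) (h : ∀ R : MvPolynomial (Fin 2) ℂ, R.IsHomogeneous (m - 3) →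
      pairing (associatedForm Q) (P * R) = 0) :
    ∃ a b : ℂ, P = a • pderiv 0 Q.1 + b • pderiv 1 Q.1 := by
  have hmem := mem_jacobianIdeal_of_pairing_eq_zero hm hQ (by omega) hP h
  rw [jacobianIdeal_eq_span_pair] at hmem
  obtain ⟨A, B, hAB⟩ := Ideal.mem_span_pair.1 hmem
  have hd : ∀ i, (pderiv i Q.1).IsHomogeneous (m - 1) := fun i => IsHomogeneous.pderiv Q.2
  have hcomp : ∀ (A : MvPolynomial (Fin 2) ℂ) (i : Fin 2) (s : Fin 2 →₀ ℕ), s.degree = m - 1 →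
      coeff s (A * pderiv i Q.1) = coeff s (constantCoeff A • pderiv i Q.1) := by
    intro A i s hs
    have h1 : (A - C (constantCoeff A)) * pderiv i Q.1 ∈ idealOfVars (Fin 2) ℂ ^ (1 + (m - 1)) := by
      rw [pow_add, pow_one]
      exact Ideal.mul_mem_mul (mem_idealOfVars_iff.2 (by simp))
        (jacobianIdeal_le_pow (Ideal.subset_span ⟨i, rfl⟩))
    have h2 := (mem_pow_idealOfVars_iff' _ _).1 h1 s (by omega)
    rwa [sub_mul, coeff_sub, sub_eq_zero, ← smul_eq_C_mul] at h2
  refine ⟨constantCoeff A, constantCoeff B, ?_⟩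
  ext s
  by_cases hs : s.degree = m - 1
  · rw [← hAB, coeff_add, coeff_add, hcomp A 0 s hs, hcomp B 1 s hs]
  · rw [hP.coeff_eq_zero hs, coeff_add, coeff_smul, coeff_smul, (hd 0).coeff_eq_zero hs,
      (hd 1).coeff_eq_zero hs, smul_zero, smul_zero, add_zero]

end Nondegenerate

/-! ### Forms of degree `N + 1` apolar to a form of degree `2 N` with non-zero catalecticant -/

/-- A form `P` of degree `n + 2` is apolar to a form `F` of degree `2 (n + 1)`. -/
def IsApolar {n : ℕ} (F : Form 2 (2 * (n + 1))) (P : MvPolynomial (Fin 2) ℂ) : Prop :=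
  ∀ R : MvPolynomial (Fin 2) ℂ, R.IsHomogeneous n → pairing F (P * R) = 0

section Apolar

variable {n : ℕ} {F G : Form 2 (2 * (n + 1))}

theorem isApolar_of_forall {P : MvPolynomial (Fin 2) ℂ}
    (h : ∀ a b, a + b = n → pairing F (P * (X 0 ^ a * X 1 ^ b)) = 0) : IsApolar F P :=
  fun _ hR => hR.linearMap_ext (φ := pairing F ∘ₗ LinearMap.mulLeft ℂ P) (ψ := 0) h

/-- A linear functional that vanishes on the apolar forms of degree `n + 2` is the pairing with
a form of degree `n`. -/
theorem exists_pairing_eq_of_isApolar (φ : MvPolynomial (Fin 2) ℂ →ₗ[ℂ] ℂ)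
    (h : ∀ P : MvPolynomial (Fin 2) ℂ, P.IsHomogeneous (n + 2) → IsApolar F P → φ P = 0) :
    ∃ T : MvPolynomial (Fin 2) ℂ, T.IsHomogeneous n ∧
      ∀ P : MvPolynomial (Fin 2) ℂ, P.IsHomogeneous (n + 2) → φ P = pairing F (P * T) := by
  let V := homogeneousSubmodule (Fin 2) ℂ (n + 2)
  let L : Fin (n + 1) → V →ₗ[ℂ] ℂ := fun i =>
    (pairing F ∘ₗ LinearMap.mulRight ℂ (X 0 ^ (n - i.1) * X 1 ^ i.1)) ∘ₗ V.subtype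
  -- The common kernel of the finitely many functionals `L i` is the space of apolar forms, so a
  -- functional vanishing there is a combination of them.
  have hspan : φ ∘ₗ V.subtype ∈ Submodule.span ℂ (Set.range L) := by
    refine mem_span_of_iInf_ker_le_ker fun P hP => ?_
    refine h P.1 P.2 (isApolar_of_forall fun a b hab => ?_)
    have := (Submodule.mem_iInf _).1 hP ⟨b, by omega⟩
    rw [LinearMap.mem_ker] at this
    subst hab
    simpa [L, mul_assoc] using this
  obtain ⟨c, hc⟩ := (Submodule.mem_span_range_iff_exists_fun ℂ).1 hspan
  refine ⟨ofVec c, isHomogeneous_ofVec c, fun P hP => ?_⟩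
  have := LinearMap.congr_fun hc ⟨P, hP⟩
  simp only [LinearMap.sum_apply, LinearMap.smul_apply, LinearMap.comp_apply,
    Submodule.subtype_apply, L, LinearMap.mulRight_apply] at this
  rw [← this, ofVec, Finset.mul_sum, map_sum]
  simp only [mul_smul_comm, map_smul]

/-- If all apolar forms vanished at `p`, evaluation at `p` would be the pairing with some `T` of
degree `n`. For the linear form `ℓ` vanishing at `p`, the product `ℓ T` is then in the kernel of the
catalecticant, so `T = 0` and evaluation at `p` is zero. -/
theorem exists_isApolar_eval_ne_zero (hF : F ∈ nonzeroCat (n + 1)) {p : Fin 2 → ℂ} (hp : p ≠ 0) :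
    ∃ P : MvPolynomial (Fin 2) ℂ, P.IsHomogeneous (n + 2) ∧ IsApolar F P ∧ eval p P ≠ 0 := by
  by_contra! hcon
  obtain ⟨T, hT, hTP⟩ := exists_pairing_eq_of_isApolar (F := F)
    (aeval p : MvPolynomial (Fin 2) ℂ →ₐ[ℂ] ℂ).toLinearMap fun P hP hPF => hcon P hP hPF
  have hTP' : ∀ P : MvPolynomial (Fin 2) ℂ, P.IsHomogeneous (n + 2) →
    eval p P = pairing F (P * T) := hTP
  have hl0 : linForm ![p 1, -p 0] ≠ 0 := fun h => by
    have := linForm_eq_zero h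
    refine hp (funext fun i => ?_)
    have h0 := congrFun this 0
    have h1 := congrFun this 1
    fin_cases i
    · simpa using h1
    · simpa using h0
  have hlT : linForm ![p 1, -p 0] * T = 0 := by
    refine mem_nonzeroCat_iff.1 hF _
      (by simpa [add_comm] using (isHomogeneous_linForm ![p 1, -p 0]).mul hT) fun R hR => ?_
    rw [mul_right_comm, ← hTP' _
      (by simpa [add_comm, add_left_comm] using (isHomogeneous_linForm ![p 1, -p 0]).mul hR),
      map_mul,
      eval_linForm]
    simp [mul_comm]
  have hT0 := (mul_eq_zero.1 hlT).resolve_left hl0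
  refine hp (funext fun i => ?_)
  have := hTP' _ (isHomogeneous_X_pow i (n + 2))
  simpa [hT0] using this

/-- A form of degree `2 (n + 1)` with non-zero catalecticant is determined up to a constant factor
by the forms of degree `n + 2` apolar to it. -/
theorem exists_pairing_eq_mul (hG : G ∈ nonzeroCat (n + 1))
    (h : ∀ P : MvPolynomial (Fin 2) ℂ, P.IsHomogeneous (n + 2) → IsApolar G P → IsApolar F P) :
    ∃ c : ℂ, ∀ P : MvPolynomial (Fin 2) ℂ, P.IsHomogeneous (2 * (n + 1)) →
      pairing F P = c * pairing G P := by
  have hex : ∀ a b : ℕ, a + b = n → ∃ T : MvPolynomial (Fin 2) ℂ, T.IsHomogeneous n ∧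
      ∀ P : MvPolynomial (Fin 2) ℂ, P.IsHomogeneous (n + 2) →
        pairing F (P * (X 0 ^ a * X 1 ^ b)) = pairing G (P * T) := fun a b hab =>
    exists_pairing_eq_of_isApolar (pairing F ∘ₗ LinearMap.mulRight ℂ (X 0 ^ a * X 1 ^ b))
      fun P hP hPG => h P hP hPG _ (hab ▸ isHomogeneous_X_pow_mul_X_pow a b)
  choose T hT hTP using hex
  -- Both sides represent the functional `R ↦ ⟨F, X 0 ^ (a + 1) * X 1 ^ (b + 1) * R⟩` through `G`,
  -- and the catalecticant of `G` is non-zero. These relations force `T a b` to be one constant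
  -- times `X 0 ^ a * X 1 ^ b`.
  have hstep : ∀ a b (hab : a + 1 + b = n),
      X 0 * T a (b + 1) (by omega) = X 1 * T (a + 1) b hab := by
    intro a b hab
    rw [← sub_eq_zero]
    refine mem_nonzeroCat_iff.1 hG _ ?_ fun R hR => ?_
    · exact (by simpa [add_comm] using (isHomogeneous_X ℂ 0).mul (hT a (b + 1) (by omega)) :
        IsHomogeneous _ (n + 1)).sub
        (by simpa [add_comm] using (isHomogeneous_X ℂ 1).mul (hT (a + 1) b hab))
    · have h0 := hTP a (b + 1) (by omega) (X 0 * R)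
        (by simpa [add_comm, add_left_comm] using (isHomogeneous_X ℂ 0).mul hR)
      have h1 := hTP (a + 1) b hab (X 1 * R)
        (by simpa [add_comm, add_left_comm] using (isHomogeneous_X ℂ 1).mul hR)
      rw [sub_mul, map_sub, mul_right_comm, mul_right_comm (X 1), ← h0, ← h1, sub_eq_zero]
      congr 1
      ring
  have hpow : ∀ b a (hab : a + b = n), X 0 ^ b * T a b hab = X 1 ^ b * T n 0 (by omega) := by
    intro b
    induction b with
    | zero =>
      intro a hab
      obtain rfl : a = n := hab
      simp
    | succ b ih =>
      intro a hab
      rw [pow_succ, mul_assoc, hstep a b (by omega), mul_left_comm, ih (a + 1) (by omega)]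
      ring
  -- At `b = n` the relation reads `X 0 ^ n * T 0 n = X 1 ^ n * T n 0`, so `X 0 ^ n` divides `T n
  -- 0`, which has degree `n`.
  obtain ⟨c, hc⟩ : ∃ c : ℂ, T n 0 (by omega) = c • X 0 ^ n := by
    have h0 := hpow n 0 (by omega)
    refine ⟨coeff (Finsupp.single 0 n) (T n 0 (by omega)), ?_⟩
    conv_lhs => rw [(hT n 0 (by omega)).eq_sum_range]
    rw [Finset.sum_eq_single 0]
    · simp
    · intro j hj hj0
      have hjn := Finset.mem_range.1 hj
      have h1 := congrArg
        (coeff (Finsupp.single 1 n + (Finsupp.single 0 (n - j) + Finsupp.single 1 j))) h0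
      rw [X_pow_eq_monomial, X_pow_eq_monomial, coeff_monomial_mul, coeff_monomial_mul',
        if_neg, one_mul] at h1
      · rw [← h1, zero_smul]
      · intro hle
        have := hle 0
        simp at this
        omega
    · simp
  have hTc : ∀ a b (hab : a + b = n), T a b hab = c • (X 0 ^ a * X 1 ^ b) := by
    intro a b hab
    refine mul_left_cancel₀ (pow_ne_zero b (X_ne_zero (R := ℂ) (0 : Fin 2))) ?_
    rw [hpow b a hab, hc, ← hab, smul_eq_C_mul, smul_eq_C_mul]
    ring
  have key : ∀ a b, a + b = n → ∀ P : MvPolynomial (Fin 2) ℂ, P.IsHomogeneous (n + 2) →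
      pairing F (P * (X 0 ^ a * X 1 ^ b)) = c * pairing G (P * (X 0 ^ a * X 1 ^ b)) := by
    intro a b hab P hP
    rw [hTP a b hab P hP, hTc a b hab, mul_smul_comm, map_smul, smul_eq_mul]
  refine ⟨c, fun P hP => hP.linearMap_ext (ψ := c • pairing G) fun a b hab => ?_⟩
  rw [LinearMap.smul_apply, smul_eq_mul]
  by_cases hb : b ≤ n
  · have := key (n - b) b (by omega) _ (isHomogeneous_X_pow 0 (n + 2))
    rwa [← mul_assoc, ← pow_add, show n + 2 + (n - b) = a by omega] at this
  · have := key 0 n (by omega) (X 0 ^ a * X 1 ^ (b - n))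
      (by simpa [show a + (b - n) = n + 2 by omega] using
        isHomogeneous_X_pow_mul_X_pow a (b - n))
    rwa [pow_zero, one_mul, mul_assoc, ← pow_add, show b - n + n = b by omega] at this

/-! ### A polynomial projection onto the apolar forms -/

/-- A linear map, polynomial in the coefficients of `F`, from the forms of degree `n + 2` to the
forms apolar to `F`; on the latter it is multiplication by the catalecticant of `F`. -/
def apolarProj (F : Form 2 (2 * (n + 1))) : MvPolynomial (Fin 2) ℂ →ₗ[ℂ] MvPolynomial (Fin 2) ℂ :=
  (catMatrix F).det • LinearMap.id -
    ∑ j : Fin (n + 2), (∑ i : Fin (n + 1), (catMatrix F).adjugate j i.castSucc •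
      (pairing F ∘ₗ LinearMap.mulRight ℂ (X 0 ^ (n - i.1) * X 1 ^ i.1))).smulRight
        (X 0 * (X 0 ^ (n + 1 - j.1) * X 1 ^ j.1))

theorem apolarProj_apply (P : MvPolynomial (Fin 2) ℂ) :
    apolarProj F P = (catMatrix F).det • P -
      ∑ j : Fin (n + 2), (∑ i : Fin (n + 1), (catMatrix F).adjugate j i.castSucc *
        pairing F (P * (X 0 ^ (n - i.1) * X 1 ^ i.1))) •
        (X 0 * (X 0 ^ (n + 1 - j.1) * X 1 ^ j.1)) := by
  simp [apolarProj, LinearMap.sum_apply, mul_assoc]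

theorem isHomogeneous_apolarProj {P : MvPolynomial (Fin 2) ℂ} (hP : P.IsHomogeneous (n + 2)) :
    (apolarProj F P).IsHomogeneous (n + 2) := by
  rw [apolarProj_apply]
  refine (homogeneousSubmodule (Fin 2) ℂ (n + 2)).sub_mem (Submodule.smul_mem _ _ hP)
    (Submodule.sum_mem _ fun j _ => Submodule.smul_mem _ _ ?_)
  have h := (isHomogeneous_X ℂ (0 : Fin 2)).mul (isHomogeneous_X_pow_mul_X_pow (n + 1 - j.1) j.1)
  rwa [show 1 + (n + 1 - j.1 + j.1) = n + 2 by have := j.2; omega] at h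

/-- Cramer's rule: the correction is sought in `X 0` times the forms of degree `n + 1`. Multiplying
the test monomials of degree `n` by `X 0` gives all monomials of degree `n + 1` but the last, hence
the rows `castSucc` of the Hankel matrix and no division by its determinant. -/
theorem isApolar_apolarProj (F : Form 2 (2 * (n + 1))) (P : MvPolynomial (Fin 2) ℂ) :
    IsApolar F (apolarProj F P) := by
  refine isApolar_of_forall fun a b hab => ?_
  let b' : Fin (n + 1) := ⟨b, by omega⟩
  set v : Fin (n + 1) → ℂ := fun i => pairing F (P * (X 0 ^ (n - i.1) * X 1 ^ i.1)) with hv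
  have h1 : ∀ j : Fin (n + 2), pairing F (X 0 * (X 0 ^ (n + 1 - j.1) * X 1 ^ j.1) *
      (X 0 ^ a * X 1 ^ b)) = catMatrix F b'.castSucc j := by
    intro j
    have := j.2
    rw [show (X 0 * (X 0 ^ (n + 1 - j.1) * X 1 ^ j.1) * (X 0 ^ a * X 1 ^ b) :
      MvPolynomial (Fin 2) ℂ) = X 0 ^ (1 + (n + 1 - j.1) + a) * X 1 ^ (b + j.1) by ring,
      pairing_X_pow_mul_X_pow F (by omega)]
    rfl
  have h2 : ∀ i : Fin (n + 1), ∑ j, catMatrix F b'.castSucc j *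
      (catMatrix F).adjugate j i.castSucc = if b' = i then (catMatrix F).det else 0 := by
    intro i
    rw [← Matrix.mul_apply, Matrix.mul_adjugate, Matrix.smul_apply, Matrix.one_apply]
    simp
  rw [apolarProj_apply, sub_mul, map_sub, Finset.sum_mul, map_sum, smul_mul_assoc, map_smul]
  simp only [smul_mul_assoc, map_smul, h1, smul_eq_mul]
  have h3 : ∑ j : Fin (n + 2), (∑ i : Fin (n + 1), (catMatrix F).adjugate j i.castSucc * v i) *
      catMatrix F b'.castSucc j = (catMatrix F).det * v b' := by
    simp only [Finset.sum_mul]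
    rw [Finset.sum_comm]
    have : ∀ i : Fin (n + 1), ∑ j, (catMatrix F).adjugate j i.castSucc * v i *
        catMatrix F b'.castSucc j = (if b' = i then (catMatrix F).det else 0) * v i := by
      intro i
      rw [← h2, Finset.sum_mul]
      exact Finset.sum_congr rfl fun j _ => by ring
    simp only [this, ite_mul, zero_mul, Finset.sum_ite_eq, Finset.mem_univ, if_true]
  rw [h3]
  simp only [hv, b', show n - b = a by omega, sub_self]

theorem apolarProj_eq_smul {P : MvPolynomial (Fin 2) ℂ} (h : IsApolar F P) :
    apolarProj F P = (catMatrix F).det • P := by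
  rw [apolarProj_apply, Finset.sum_eq_zero, sub_zero]
  intro j _
  rw [Finset.sum_eq_zero, zero_smul]
  intro i _
  rw [h, mul_zero]
  simpa [Nat.sub_add_cancel (Nat.lt_succ_iff.1 i.2)] using
    isHomogeneous_X_pow_mul_X_pow (n - i.1) i.1

end Apolar

/-! ### Closedness of the orbits of stable forms -/

theorem isPolyFun_normCoeff {d : ℕ} (j : ℕ) : IsPolyFun (fun F : Form 2 d => normCoeff F j) := by
  simpa only [normCoeff, div_eq_mul_inv] using (IsPolyFun.coeff _).mul (IsPolyFun.const _)

theorem isPolyFun_pairing {d : ℕ} (P : MvPolynomial (Fin 2) ℂ) :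
    IsPolyFun (fun F : Form 2 d => pairing F P) := by
  simp only [pairing, LinearMap.sum_apply, LinearMap.smul_apply, smul_eq_mul]
  exact IsPolyFun.sum _ fun j _ => (isPolyFun_normCoeff j).mul (IsPolyFun.const _)

theorem isHomPolyFun_pairing {σ : Type*} {d e : ℕ} (F : Form 2 d)
    {P : (σ → ℂ) → MvPolynomial (Fin 2) ℂ} (hP : ∀ s, IsHomPolyFun e (fun x => coeff s (P x))) :
    IsHomPolyFun e (fun x => pairing F (P x)) := by
  simp only [pairing, LinearMap.sum_apply, LinearMap.smul_apply, smul_eq_mul, lcoeff_apply]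
  exact IsHomPolyFun.sum _ fun j _ => (hP _).const_mul _

theorem isHomPolyFun_coeff_linForm {σ : Type*} {z : (σ → ℂ) → Fin 2 → ℂ}
    (hz : ∀ i, IsHomPolyFun 1 (fun x => z x i)) (s : Fin 2 →₀ ℕ) :
    IsHomPolyFun 1 (fun x => coeff s (linForm (z x))) := by
  simp only [linForm, coeff_add, coeff_smul, smul_eq_mul, mul_comm (z _ _)]
  exact ((hz 0).const_mul _).add ((hz 1).const_mul _)

theorem isHomPolyFun_coeff_lsub_mul (a b : ℕ) (R : MvPolynomial (Fin 2) ℂ) (s : Fin 2 →₀ ℕ) :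
    IsHomPolyFun (a + b) (fun x : Fin 2 × Fin 2 → ℂ =>
      coeff s (lsub (Matrix.of fun i j => x (i, j)) (X 0 ^ a * X 1 ^ b) * R)) := by
  have h : ∀ i s, IsHomPolyFun 1 (fun x : Fin 2 × Fin 2 → ℂ =>
      coeff s (linForm ((Matrix.of fun i j => x (i, j)) i))) := fun i s =>
    isHomPolyFun_coeff_linForm (fun j => IsHomPolyFun.proj (i, j)) s
  simp only [map_mul, map_pow, lsub_X]
  have h1 := IsHomPolyFun.coeff_mul (IsHomPolyFun.coeff_mul (IsHomPolyFun.coeff_pow (h 0) a)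
    (IsHomPolyFun.coeff_pow (h 1) b)) (IsHomPolyFun.coeff_const R) s
  rwa [mul_one, mul_one, add_zero] at h1

theorem lsub_rank_one {d : ℕ} {P : MvPolynomial (Fin 2) ℂ}
    (hP : P.IsHomogeneous d) (p l : Fin 2 → ℂ) :
    lsub (Matrix.of fun i j => p i * l j) P = eval p P • linForm l ^ d := by
  refine MvPolynomial.funext fun z => ?_
  have : (Matrix.of fun i j => p i * l j).mulVec z = (l 0 * z 0 + l 1 * z 1) • p := by
    ext i
    simp only [Matrix.mulVec, dotProduct, Fin.sum_univ_two, Matrix.of_apply, Pi.smul_apply,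
      smul_eq_mul]
    ring
  rw [eval_lsub, this, hP.eval_smul, smul_eval, map_pow, eval_linForm, mul_comm]

theorem exists_rank_one {A : Matrix (Fin 2) (Fin 2) ℂ} (hA : A ≠ 0) (hdet : A.det = 0) :
    ∃ p l : Fin 2 → ℂ, p ≠ 0 ∧ l ≠ 0 ∧ A = Matrix.of fun i j => p i * l j := by
  rw [Matrix.det_fin_two] at hdet
  have hor : (∃ j, A 0 j ≠ 0) ∨ ∃ j, A 1 j ≠ 0 := by
    by_contra! h
    refine hA (Matrix.ext fun i j => ?_)
    fin_cases i
    · exact h.1 j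
    · exact h.2 j
  have key : ∀ i i' j, A i j ≠ 0 → ∀ j', A i' j' = A i' j / A i j * A i j' := by
    intro i i' j hij j'
    rw [div_mul_eq_mul_div, eq_div_iff hij]
    fin_cases i <;> fin_cases i' <;> fin_cases j <;> fin_cases j' <;>
      simp only [Fin.zero_eta, Fin.mk_one] <;>
      first | ring1 | linear_combination hdet | linear_combination -hdet
  have main : ∀ i j, A i j ≠ 0 →
      ∃ p l : Fin 2 → ℂ, p ≠ 0 ∧ l ≠ 0 ∧ A = Matrix.of fun i j => p i * l j := by
    intro i j hij
    refine ⟨fun i' => A i' j / A i j, A i, fun h => ?_, fun h => hij (congrFun h j),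
      Matrix.ext fun i' j' => key i i' j hij j'⟩
    have := congrFun h i
    simp [hij] at this
  rcases hor with ⟨j, hj⟩ | ⟨j, hj⟩
  · exact main 0 j hj
  · exact main 1 j hj

/-- If `A` has rank one, an apolar form of `G` not vanishing at its column vector is sent to a
non-zero multiple of `linForm l ^ (n + 2)`, against `hst`. If `A` is invertible, the transform of
`F` has the apolar forms of `G`, so it is a multiple of `G`, and a root of the scalar is absorbed in
`A`. -/
theorem mem_glOrbit_of_pairing_lsub {n : ℕ} {F G : Form 2 (2 * (n + 1))}
    (hF : F ∈ nonzeroCat (n + 1)) (hG : G ∈ nonzeroCat (n + 1))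
    (hst : ∀ l, IsApolar F (linForm l ^ (n + 2)) → l = 0) {A : Matrix (Fin 2) (Fin 2) ℂ}
    (hA : A ≠ 0) (h : ∀ P : MvPolynomial (Fin 2) ℂ, P.IsHomogeneous (n + 2) → IsApolar G P →
      IsApolar F (lsub A P)) : G ∈ glOrbit F := by
  by_cases hdet : A.det = 0
  · obtain ⟨p, l, hp, hl, rfl⟩ := exists_rank_one hA hdet
    obtain ⟨P, hP, hPG, hne⟩ := exists_isApolar_eval_ne_zero hG hp
    refine absurd (hst l fun R hR => ?_) hl
    have := h P hP hPG R hR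
    rw [lsub_rank_one hP, smul_mul_assoc, map_smul, smul_eq_mul] at this
    exact (mul_eq_zero.1 this).resolve_left hne
  · let F' : Form 2 (2 * (n + 1)) := ⟨lsub A.transpose F.1, isHomogeneous_lsub _ F.2⟩
    have hF' : ∀ P : MvPolynomial (Fin 2) ℂ, P.IsHomogeneous (2 * (n + 1)) →
        pairing F' P = pairing F (lsub A P) := fun P hP => by
      rw [pairing_lsub (F := F) (G := F') rfl hP, Matrix.transpose_transpose]
    have horb : F' ∈ glOrbit F := mem_glOrbit_iff_pairing.2 ⟨A, hdet, hF'⟩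
    have hF'Y := glOrbit_subset_nonzeroCat hF horb
    obtain ⟨c, hc⟩ := exists_pairing_eq_mul (F := F') hG fun P hP hPG R hR => by
      rw [hF' _ (by simpa [two_mul, add_assoc, add_comm, add_left_comm] using hP.mul hR), map_mul]
      exact h P hP hPG _ (isHomogeneous_lsub A hR)
    have hc0 : c ≠ 0 := by
      rintro rfl
      have h1 := mem_nonzeroCat_iff.1 hF'Y (X 0 ^ (n + 1)) (isHomogeneous_X_pow _ _) fun R hR => by
        rw [hc _ (by simpa [two_mul] using (isHomogeneous_X_pow (0 : Fin 2) (n + 1)).mul hR),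
          zero_mul]
      exact pow_ne_zero _ (X_ne_zero _) h1
    obtain ⟨r, hr⟩ := IsAlgClosed.exists_pow_nat_eq c⁻¹ (n := 2 * (n + 1)) (by omega)
    have hr0 : r ≠ 0 := by
      rintro rfl
      rw [zero_pow (by omega)] at hr
      exact inv_ne_zero hc0 hr.symm
    refine mem_glOrbit_iff_pairing.2 ⟨r • A, ?_, fun P hP => ?_⟩
    · rw [Matrix.det_smul]
      exact mul_ne_zero (pow_ne_zero _ hr0) hdet
    · rw [lsub_smul _ _ hP, hr, map_smul, ← hF' P hP, hc P hP, smul_eq_mul,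
        inv_mul_cancel_left₀ hc0]

/-- Elimination applied to the entries of `A`. The apolar forms of `G` vary with `G`, so they are
parametrized by `apolarProj G`; this makes the equations polynomial in `G` and homogeneous of degree
`n + 2` in `A`. -/
theorem exists_polyFun_of_stable {n : ℕ} {F G₀ : Form 2 (2 * (n + 1))}
    (hF : F ∈ nonzeroCat (n + 1)) (hst : ∀ l, IsApolar F (linForm l ^ (n + 2)) → l = 0)
    (hG₀ : G₀ ∈ nonzeroCat (n + 1)) (hG₀F : G₀ ∉ glOrbit F) :
    ∃ D : Form 2 (2 * (n + 1)) → ℂ, IsPolyFun D ∧ D G₀ ≠ 0 ∧ ∀ G ∈ glOrbit F, D G = 0 := by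
  let mono : ℕ → ℕ → MvPolynomial (Fin 2) ℂ := fun d j => X 0 ^ (d - j) * X 1 ^ j
  let mat : (Fin 2 × Fin 2 → ℂ) → Matrix (Fin 2) (Fin 2) ℂ := fun x => Matrix.of fun i j => x (i, j)
  -- An equation is indexed by a monomial of degree `n + 2` to project and a test monomial of degree
  -- `n`. The index `none` is the determinant term of `apolarProj`, and `some j` its `j`-th
  -- correction term.
  let κ : Fin (n + 3) × Fin (n + 1) → Option (Fin (n + 2)) → Form 2 (2 * (n + 1)) → ℂ :=
    fun i j G => j.elim (catMatrix G).det fun j => -∑ k : Fin (n + 1),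
      (catMatrix G).adjugate j k.castSucc * pairing G (mono (n + 2) i.1 * mono n k)
  let g : Fin (n + 3) × Fin (n + 1) → Option (Fin (n + 2)) → (Fin 2 × Fin 2 → ℂ) → ℂ :=
    fun i j x => j.elim (pairing F (lsub (mat x) (mono (n + 2) i.1) * mono n i.2))
      fun j => pairing F (lsub (mat x) (X 0 ^ (n + 1 - j.1 + 1) * X 1 ^ j.1) * mono n i.2)
  have hsum : ∀ i G x, ∑ j, κ i j G * g i j x =
      pairing F (lsub (mat x) (apolarProj G (mono (n + 2) i.1)) * mono n i.2) := by
    intro i G x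
    rw [Fintype.sum_option, apolarProj_apply]
    simp only [κ, g, Option.elim, map_sub, map_smul, map_sum, sub_mul, Finset.sum_mul,
      smul_mul_assoc, smul_eq_mul]
    rw [sub_eq_add_neg, ← Finset.sum_neg_distrib]
    congr 1
    refine Finset.sum_congr rfl fun j _ => ?_
    rw [neg_mul, Finset.sum_mul, show (X 0 ^ (n + 1 - j.1 + 1) * X 1 ^ j.1 :
      MvPolynomial (Fin 2) ℂ) = X 0 * (X 0 ^ (n + 1 - j.1) * X 1 ^ j.1) by ring]
  have hmat : ∀ i j, IsPolyFun (fun G : Form 2 (2 * (n + 1)) => catMatrix G i j) := fun i j =>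
    isPolyFun_normCoeff _
  have hmono : ∀ d j, j < d + 1 → (mono d j).IsHomogeneous d := fun d j hj => by
    simpa [Nat.sub_add_cancel (Nat.lt_succ_iff.1 hj)] using
      isHomogeneous_X_pow_mul_X_pow (d - j) j
  obtain ⟨D, hD, hD₀, hDz⟩ := exists_polyFun_of_no_common_zero (e := n + 2) κ
    (fun i j => by
      cases j with
      | none => exact IsPolyFun.det hmat
      | some j =>
        exact (IsPolyFun.sum _ fun k _ =>
          (IsPolyFun.adjugate hmat _ _).mul (isPolyFun_pairing _)).neg)
    g
    (fun i j => by
      cases j with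
      | none =>
        have h := isHomPolyFun_pairing F
          (isHomPolyFun_coeff_lsub_mul (n + 2 - i.1.1) i.1.1 (mono n i.2))
        rwa [show n + 2 - i.1.1 + i.1.1 = n + 2 by have := i.1.2; omega] at h
      | some j =>
        have h := isHomPolyFun_pairing F
          (isHomPolyFun_coeff_lsub_mul (n + 1 - j.1 + 1) j.1 (mono n i.2))
        rwa [show n + 1 - j.1 + 1 + j.1 = n + 2 by have := j.2; omega] at h)
    G₀
    (fun x hx => by
      by_contra hx0
      refine hG₀F (mem_glOrbit_of_pairing_lsub hF hG₀ hst (A := mat x) (fun h0 => hx0 ?_)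
        fun P hP hPG => isApolar_of_forall fun a b hab => ?_)
      · ext ⟨i, j⟩
        exact congrFun (congrFun h0 i) j
      · have hz := hP.linearMap_ext (φ := pairing F ∘ₗ LinearMap.mulRight ℂ (X 0 ^ a * X 1 ^ b) ∘ₗ
          (lsub (mat x)).toLinearMap ∘ₗ apolarProj G₀) (ψ := 0) fun a' b' hab' => by
            have := hx (⟨b', by omega⟩, ⟨b, by omega⟩)
            rw [hsum] at this
            simp only [mono, show n + 2 - b' = a' by omega, show n - b = a by omega] at this
            exact this
        simp only [LinearMap.comp_apply, LinearMap.mulRight_apply, AlgHom.toLinearMap_apply,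
          LinearMap.zero_apply, apolarProj_eq_smul hPG, map_smul, smul_eq_mul] at hz
        exact (mul_eq_zero.1 hz).resolve_left hG₀)
  refine ⟨D, hD, hD₀, fun G hG => ?_⟩
  obtain ⟨A, hA, hAG⟩ := mem_glOrbit_iff_pairing.1 hG
  have hu : IsUnit A.det := hA.isUnit
  refine hDz G (fun ij => A ij.1 ij.2) (fun h0 => hA ?_) fun i => ?_
  · have : A = 0 := Matrix.ext fun i j => congrFun h0 (i, j)
    rw [this, Matrix.det_zero]
  · refine (hsum i G fun ij => A ij.1 ij.2).trans ?_
    have h1 := isApolar_apolarProj G (mono (n + 2) i.1) (lsub A⁻¹ (mono n i.2))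
      (isHomogeneous_lsub _ (hmono _ _ i.2.2))
    rw [hAG, map_mul, lsub_lsub, Matrix.nonsing_inv_mul _ hu, lsub_one] at h1
    · exact h1
    · have := (isHomogeneous_apolarProj (F := G) (hmono (n + 2) i.1 i.1.2)).mul
        (isHomogeneous_lsub A⁻¹ (hmono n i.2 i.2.2))
      rwa [show n + 2 + n = 2 * (n + 1) by ring] at this

/-! ### Closedness of the orbit of `z₁ ^ N * z₂ ^ N` -/

theorem lsub_X_pow_mul_X_pow (A : Matrix (Fin 2) (Fin 2) ℂ) (a b : ℕ) :
    lsub A (X 0 ^ a * X 1 ^ b) = linForm (A 0) ^ a * linForm (A 1) ^ b := by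
  rw [map_mul, map_pow, map_pow, lsub_X, lsub_X]

theorem mem_glOrbit_of_eq_smul_lsub {d : ℕ} (hd : d ≠ 0) {F G : Form 2 d}
    {P : MvPolynomial (Fin 2) ℂ} {A B : Matrix (Fin 2) (Fin 2) ℂ} (hA : A.det ≠ 0)
    (hB : B.det ≠ 0) {c e : ℂ} (hc : c ≠ 0) (he : e ≠ 0) (hF : F.1 = c • lsub A P)
    (hG : G.1 = e • lsub B P) : G ∈ glOrbit F := by
  obtain ⟨r, hr⟩ := IsAlgClosed.exists_pow_nat_eq (e * c⁻¹) (Nat.pos_of_ne_zero hd)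
  have hr0 : r ≠ 0 := by
    rintro rfl
    rw [zero_pow hd] at hr
    exact mul_ne_zero he (inv_ne_zero hc) hr.symm
  have hu : IsUnit A.det := hA.isUnit
  refine mem_glOrbit_iff_lsub.2 ⟨r • (A⁻¹ * B), ?_, ?_⟩
  · rw [Matrix.det_smul, Matrix.det_mul]
    exact mul_ne_zero (pow_ne_zero _ hr0)
      (mul_ne_zero (Matrix.isUnit_nonsing_inv_det _ hu).ne_zero hB)
  · rw [lsub_smul _ _ F.2, hr, hF, map_smul, lsub_lsub, ← mul_assoc, Matrix.mul_nonsing_inv _ hu,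
      one_mul, smul_smul, inv_mul_cancel_right₀ hc, hG]

/-- The binary quadratic form with given coefficients. -/
def quadForm (x : Fin 3 → ℂ) : MvPolynomial (Fin 2) ℂ :=
  x 0 • X 0 ^ 2 + x 1 • (X 0 * X 1) + x 2 • X 1 ^ 2

theorem eval_quadForm (x : Fin 3 → ℂ) (z : Fin 2 → ℂ) :
    eval z (quadForm x) = x 0 * z 0 ^ 2 + x 1 * (z 0 * z 1) + x 2 * z 1 ^ 2 := by
  simp [quadForm, smul_eval]

theorem quadForm_eq_zero {x : Fin 3 → ℂ} (h : quadForm x = 0) : x = 0 := by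
  have h' : ∀ z : Fin 2 → ℂ, x 0 * z 0 ^ 2 + x 1 * (z 0 * z 1) + x 2 * z 1 ^ 2 = 0 := fun z => by
    rw [← eval_quadForm, h, map_zero]
  have h0 := h' ![1, 0]
  have h2 := h' ![0, 1]
  have h1 := h' ![1, 1]
  simp at h0 h1 h2
  ext i
  fin_cases i
  · exact h0
  · simpa [h0, h2] using h1
  · exact h2

theorem linForm_mul_linForm (α β : Fin 2 → ℂ) : linForm α * linForm β =
    quadForm ![α 0 * β 0, α 0 * β 1 + α 1 * β 0, α 1 * β 1] := by
  refine MvPolynomial.funext fun z => ?_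
  rw [map_mul, eval_linForm, eval_linForm, eval_quadForm]
  simp
  ring

theorem exists_quadForm_eq_mul (x : Fin 3 → ℂ) :
    ∃ α β : Fin 2 → ℂ, quadForm x = linForm α * linForm β := by
  by_cases h0 : x 0 = 0
  · refine ⟨![0, 1], ![x 1, x 2], MvPolynomial.funext fun z => ?_⟩
    rw [map_mul, eval_linForm, eval_linForm, eval_quadForm]
    simp [h0]
    ring
  · obtain ⟨s, hs⟩ := IsAlgClosed.exists_pow_nat_eq (discrim (x 0) (x 1) (x 2)) (n := 2) (by simp)
    obtain ⟨r, hr⟩ := exists_quadratic_eq_zero h0 ⟨s, by rw [← hs, pow_two]⟩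
    refine ⟨![1, -r], ![x 0, x 1 + x 0 * r], MvPolynomial.funext fun z => ?_⟩
    rw [map_mul, eval_linForm, eval_linForm, eval_quadForm]
    simp
    linear_combination z 1 ^ 2 * hr

/-- The functional of such a form is a multiple of evaluation at `l`, so the `(n + 1)`-st power of
the linear form vanishing at `l` is in the kernel of the catalecticant. -/
theorem notMem_nonzeroCat_of_eq_smul_linForm_pow {n : ℕ} {F : Form 2 (2 * (n + 1))} {c : ℂ}
    {l : Fin 2 → ℂ} (hl : l ≠ 0) (hF : F.1 = c • linForm l ^ (2 * (n + 1))) :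
    F ∉ nonzeroCat (n + 1) := by
  intro h
  have hp : ∀ P : MvPolynomial (Fin 2) ℂ, P.IsHomogeneous (2 * (n + 1)) →
      pairing F P = c * eval l P := fun P hP => by
    refine pairing_eq_of_eval (φ := c • (aeval l : MvPolynomial (Fin 2) ℂ →ₐ[ℂ] ℂ).toLinearMap)
      (fun z => ?_) hP
    have : (aeval l : MvPolynomial (Fin 2) ℂ →ₐ[ℂ] ℂ) (linForm z ^ (2 * (n + 1))) =
      eval l (linForm z ^ (2 * (n + 1))) := rfl
    rw [LinearMap.smul_apply, AlgHom.toLinearMap_apply, this, hF, smul_eval, map_pow, map_pow,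
      eval_linForm, eval_linForm, smul_eq_mul]
    ring
  have h0 := mem_nonzeroCat_iff.1 h (linForm ![l 1, -l 0] ^ (n + 1))
    (isHomogeneous_linForm_pow _ _) fun R hR => by
      rw [hp _ (by simpa [two_mul] using (isHomogeneous_linForm_pow ![l 1, -l 0] (n + 1)).mul hR),
        map_mul, map_pow, eval_linForm]
      simp [mul_comm]
  have h1 := linForm_eq_zero (eq_zero_of_pow_eq_zero h0)
  refine hl (funext fun i => ?_)
  fin_cases i
  · simpa using congrFun h1 1
  · simpa using congrFun h1 0

theorem isHomPolyFun_coeff_quadForm_pow (N : ℕ) (s : Fin 2 →₀ ℕ) :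
    IsHomPolyFun N (fun x : Fin 3 → ℂ => coeff s (quadForm x ^ N)) := by
  have h : ∀ s, IsHomPolyFun 1 (fun x : Fin 3 → ℂ => coeff s (quadForm x)) := fun s => by
    simp only [quadForm, coeff_add, coeff_smul, smul_eq_mul, mul_comm _ (coeff s _)]
    exact (((IsHomPolyFun.proj 0).const_mul _).add ((IsHomPolyFun.proj 1).const_mul _)).add
      ((IsHomPolyFun.proj 2).const_mul _)
  simpa using IsHomPolyFun.coeff_pow h N s

/-- Elimination applied to the three coefficients of a quadratic form `q`: the equations are the `2
× 2` minors saying that `G` and `q ^ (n + 1)` are proportional. At `G₀` a solution `q ≠ 0` splits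
into two linear factors; dependent ones contradict `hG₀`, independent ones `hG₀F`. -/
theorem exists_polyFun_of_polystable {n : ℕ} {F G₀ : Form 2 (2 * (n + 1))}
    {A : Matrix (Fin 2) (Fin 2) ℂ} (hA : A.det ≠ 0) {c : ℂ} (hc : c ≠ 0)
    (hFY : F ∈ nonzeroCat (n + 1)) (hF : F.1 = c • lsub A (X 0 ^ (n + 1) * X 1 ^ (n + 1)))
    (hG₀ : G₀ ∈ nonzeroCat (n + 1)) (hG₀F : G₀ ∉ glOrbit F) :
    ∃ D : Form 2 (2 * (n + 1)) → ℂ, IsPolyFun D ∧ D G₀ ≠ 0 ∧ ∀ G ∈ glOrbit F, D G = 0 := by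
  let κ : (Fin 2 →₀ ℕ) × (Fin 2 →₀ ℕ) → Bool → Form 2 (2 * (n + 1)) → ℂ :=
    fun i j G => j.rec (-coeff i.2 G.1) (coeff i.1 G.1)
  let g : (Fin 2 →₀ ℕ) × (Fin 2 →₀ ℕ) → Bool → (Fin 3 → ℂ) → ℂ :=
    fun i j x => j.rec (coeff i.1 (quadForm x ^ (n + 1))) (coeff i.2 (quadForm x ^ (n + 1)))
  have hsum : ∀ i G x, ∑ j, κ i j G * g i j x = coeff i.1 G.1 * coeff i.2 (quadForm x ^ (n + 1)) -
      coeff i.2 G.1 * coeff i.1 (quadForm x ^ (n + 1)) := fun i G x => by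
    rw [Fintype.sum_bool]
    simp only [κ, g]
    ring
  obtain ⟨D, hD, hD₀, hDz⟩ := exists_polyFun_of_no_common_zero (e := n + 1) κ
    (fun i j => by
      cases j with
      | false => exact (IsPolyFun.coeff _).neg
      | true => exact IsPolyFun.coeff _)
    g
    (fun i j => by cases j <;> exact isHomPolyFun_coeff_quadForm_pow _ _)
    G₀
    (fun x hx => by
      by_contra hx0
      have hq0 : quadForm x ≠ 0 := fun h => hx0 (quadForm_eq_zero h)
      obtain ⟨s, hs⟩ := ne_zero_iff.1 (ne_zero_of_mem_nonzeroCat hG₀)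
      set μ := coeff s (quadForm x ^ (n + 1)) / coeff s G₀.1 with hμ
      have hq : quadForm x ^ (n + 1) = μ • G₀.1 := by
        ext t
        have := hx (s, t)
        rw [hsum] at this
        rw [coeff_smul, smul_eq_mul, hμ]
        field_simp
        linear_combination this
      have hμ0 : μ ≠ 0 := fun h => pow_ne_zero (n + 1) hq0 (by rw [hq, h, zero_smul])
      have hG : G₀.1 = μ⁻¹ • quadForm x ^ (n + 1) := by
        rw [hq, smul_smul, inv_mul_cancel₀ hμ0, one_smul]
      obtain ⟨α, β, hαβ⟩ := exists_quadForm_eq_mul x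
      by_cases hdet : (Matrix.of ![α, β]).det = 0
      · have hne : Matrix.of ![α, β] ≠ 0 := fun h => hq0 <| by
          have : α = 0 := congrFun h 0
          simp [hαβ, this, linForm]
        obtain ⟨p, l, -, hl, hpl⟩ := exists_rank_one hne hdet
        have hα : α = p 0 • l := congrFun hpl 0
        have hβ : β = p 1 • l := congrFun hpl 1
        refine notMem_nonzeroCat_of_eq_smul_linForm_pow hl
          (c := μ⁻¹ * (p 0 * p 1) ^ (n + 1)) ?_ hG₀
        rw [hG, hαβ, hα, hβ, linForm_smul, linForm_smul, smul_mul_smul_comm, smul_pow, ← pow_two,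
          ← pow_mul, smul_smul]
      · exact hG₀F (mem_glOrbit_of_eq_smul_lsub (by omega) hA hdet hc (inv_ne_zero hμ0) hF
          (by rw [lsub_X_pow_mul_X_pow, hG, hαβ, mul_pow]; rfl)))
  refine ⟨D, hD, hD₀, fun G hG => ?_⟩
  obtain ⟨B, hB, hGB⟩ := mem_glOrbit_iff_lsub.1 hG
  obtain ⟨x, hx⟩ : ∃ x, linForm ((A * B) 0) * linForm ((A * B) 1) = quadForm x :=
    ⟨_, linForm_mul_linForm _ _⟩
  rw [hF, map_smul, lsub_lsub, lsub_X_pow_mul_X_pow, ← mul_pow, hx] at hGB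
  refine hDz G x (fun h0 => ne_zero_of_mem_nonzeroCat (glOrbit_subset_nonzeroCat hFY hG) ?_)
    fun i => (hsum i G x).trans ?_
  · rw [hGB, h0]
    simp [quadForm]
  · rw [hGB, coeff_smul, coeff_smul, smul_eq_mul, smul_eq_mul]
    ring

/-! ### Forms of which some derivative is a power of a linear form -/

theorem pderiv_pderiv_comm {σ : Type*} (i j : σ) (P : MvPolynomial σ ℂ) :
    pderiv i (pderiv j P) = pderiv j (pderiv i P) := by
  classical
  let D : Derivation ℂ (MvPolynomial σ ℂ) (MvPolynomial σ ℂ) :=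
    ⁅(pderiv i : Derivation ℂ (MvPolynomial σ ℂ) (MvPolynomial σ ℂ)), pderiv j⁆
  have hD : ∀ p, D p = pderiv i (pderiv j p) - pderiv j (pderiv i p) := fun p =>
    Derivation.commutator_apply p
  have h0 : D = 0 := derivation_ext fun k => by
    rw [hD]
    simp [pderiv_X, Pi.single_apply, apply_ite]
  rw [← sub_eq_zero, ← hD, h0, Derivation.zero_apply]

/-- A binary form that is annihilated by the derivative in the direction `(a, b)` is a multiple of
a power of the linear form that vanishes at `(a, b)`. -/
theorem eq_smul_linForm_pow_of_pderiv {a b : ℂ} (hab : a ≠ 0 ∨ b ≠ 0) {d : ℕ}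
    {P : MvPolynomial (Fin 2) ℂ} (hP : P.IsHomogeneous d)
    (h : a • pderiv 0 P + b • pderiv 1 P = 0) : ∃ c : ℂ, P = c • linForm ![b, -a] ^ d := by
  induction d generalizing P with
  | zero =>
    refine ⟨coeff 0 P, ?_⟩
    conv_lhs => rw [totalDegree_eq_zero_iff_eq_C.1 ((totalDegree_zero_iff_isHomogeneous _).2 hP)]
    rw [pow_zero, smul_eq_C_mul, mul_one]
  | succ d ih =>
    have hcomm : ∀ i, a • pderiv 0 (pderiv i P) + b • pderiv 1 (pderiv i P) = 0 := fun i => by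
      have := congrArg (pderiv i) h
      rw [map_add, Derivation.map_smul, Derivation.map_smul, map_zero] at this
      rw [← this, pderiv_pderiv_comm i 0, pderiv_pderiv_comm i 1]
    obtain ⟨c₀, h₀⟩ := ih (P := pderiv 0 P) (IsHomogeneous.pderiv hP) (hcomm 0)
    obtain ⟨c₁, h₁⟩ := ih (P := pderiv 1 P) (IsHomogeneous.pderiv hP) (hcomm 1)
    have hl : linForm ![b, -a] ≠ 0 := fun hl => by
      have := linForm_eq_zero hl
      have hb := congrFun this 0
      have ha := congrFun this 1
      simp at ha hb
      simp [ha, hb] at hab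
    have hac : a * c₀ + b * c₁ = 0 := by
      rw [h₀, h₁, smul_smul, smul_smul, ← add_smul] at h
      exact (smul_eq_zero.1 h).resolve_right (pow_ne_zero _ hl)
    obtain ⟨t, ht₀, ht₁⟩ : ∃ t, c₀ = t * b ∧ c₁ = -(t * a) := by
      rcases hab with ha | hb
      · refine ⟨-c₁ / a, ?_, ?_⟩ <;> field_simp
        linear_combination hac
      · refine ⟨c₀ / b, ?_, ?_⟩ <;> field_simp
        linear_combination hac
    have hd : ((d + 1 : ℕ) : ℂ) ≠ 0 := by exact_mod_cast d.succ_ne_zero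
    refine ⟨((d + 1 : ℕ) : ℂ)⁻¹ * t, MvPolynomial.funext fun z => ?_⟩
    have he := congrArg (eval z) (euler_fin_two hP)
    rw [h₀, h₁, ht₀, ht₁] at he
    simp only [map_add, map_mul, map_pow, smul_eval, eval_X, eval_C, eval_linForm] at he
    rw [smul_eval, map_pow, eval_linForm, pow_succ, mul_assoc, eq_inv_mul_iff_mul_eq₀ hd, ← he]
    simp
    ring

section Nondegenerate

variable {m : ℕ} {Q : Form 2 m}

theorem eq_zero_of_eval_pderiv_eq_zero (hm : 3 ≤ m) (hQ : Q ∈ nondegenerateForms m)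
    {p : Fin 2 → ℂ} (h : ∀ i, eval p (pderiv i Q.1) = 0) :
    p = 0 := by
  ext i
  have hmem := mem_jacobianIdeal_of_isHomogeneous hm hQ
    (isHomogeneous_X_pow i (2 * (m - 2) + 1))
  rw [jacobianIdeal_eq_span_pair] at hmem
  obtain ⟨A, B, hAB⟩ := Ideal.mem_span_pair.1 hmem
  have := congrArg (eval p) hAB
  rw [map_add, map_mul, map_mul, h, h, map_pow, eval_X, mul_zero, mul_zero, add_zero] at this
  exact eq_zero_of_pow_eq_zero this.symm

/-- If a derivative of a nondegenerate form in the direction of a vector is a power of a linear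
form, then the linear form does not vanish at that vector. -/
theorem eval_linForm_ne_zero_of_linForm_pow (hm : 3 ≤ m) (hQ : Q ∈ nondegenerateForms m)
    {a b : ℂ} {l : Fin 2 → ℂ} (hl : l ≠ 0)
    (h : linForm l ^ (m - 1) = a • pderiv 0 Q.1 + b • pderiv 1 Q.1) :
    l 0 * a + l 1 * b ≠ 0 := by
  intro hs
  -- By Euler, differentiating `∂_u Q` and evaluating at `u = (a, b)` gives `(m - 1)` times the
  -- gradient of `Q` at `u`. The left side vanishes because `l ^ (m - 1)` has a multiple zero at
  -- `u`, and the gradient has no non-zero zero.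
  have hu : ![a, b] = 0 := by
    refine eq_zero_of_eval_pderiv_eq_zero hm hQ fun i => ?_
    have hd : (pderiv i Q.1).IsHomogeneous (m - 1) := IsHomogeneous.pderiv Q.2
    have he := congrArg (eval ![a, b]) (euler_fin_two hd)
    have h1 := congrArg (eval ![a, b]) (congrArg (pderiv i) h)
    have h2 : eval ![a, b] (pderiv i (linForm l ^ (m - 1))) = 0 := by
      rw [pderiv_pow, map_mul, map_mul, map_pow, eval_linForm]
      simp [hs, show m - 1 - 1 ≠ 0 by omega]
    rw [h2, map_add, Derivation.map_smul, Derivation.map_smul, pderiv_pderiv_comm i 0,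
      pderiv_pderiv_comm i 1] at h1
    simp only [map_add, map_mul, smul_eval, eval_X, eval_C] at he h1
    simp only [Matrix.cons_val_zero, Matrix.cons_val_one] at he
    rw [← h1] at he
    exact (mul_eq_zero.1 he.symm).resolve_left (natCast_pred_ne_zero hm)
  have ha : a = 0 := congrFun hu 0
  have hb : b = 0 := congrFun hu 1
  rw [ha, hb, zero_smul, zero_smul, add_zero] at h
  exact hl (linForm_eq_zero (eq_zero_of_pow_eq_zero h))

/-- Here `Q = k l ^ m + c l' ^ m` with `l' = linForm ![b, -a]`. The constant `k` is chosen so that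
`Q - k l ^ m` has zero derivative along `(a, b)`; nondegeneracy forces `c ≠ 0`, and subtracting
multiples of `l ^ (m - 1)` from the partials leaves `l' ^ (m - 1)`. -/
theorem linForm_pow_mem_jacobianIdeal (hm : 3 ≤ m) (hQ : Q ∈ nondegenerateForms m)
    {a b : ℂ} {l : Fin 2 → ℂ} (hl : l ≠ 0)
    (h : linForm l ^ (m - 1) = a • pderiv 0 Q.1 + b • pderiv 1 Q.1) :
    linForm ![b, -a] ^ (m - 1) ∈ jacobianIdeal Q.1 := by
  have hs := eval_linForm_ne_zero_of_linForm_pow hm hQ hl h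
  set s := l 0 * a + l 1 * b with hs_def
  have hab : a ≠ 0 ∨ b ≠ 0 := by
    by_contra! hcon
    exact hs (by rw [hs_def, hcon.1, hcon.2]; ring)
  have hm0 : (m : ℂ) ≠ 0 := by exact_mod_cast (by omega : m ≠ 0)
  have hder : ∀ (v : Fin 2 → ℂ) (i : Fin 2),
      pderiv i (linForm v ^ m) = (m * v i) • linForm v ^ (m - 1) := fun v i => by
    have : pderiv i (linForm v) = C (v i) := by
      fin_cases i <;> simp [linForm, pderiv_X, smul_eq_C_mul]
    rw [pderiv_pow, this, smul_eq_C_mul, C_mul, map_natCast]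
    ring
  set k := ((m : ℂ) * s)⁻¹ with hk
  obtain ⟨c, hc⟩ := eq_smul_linForm_pow_of_pderiv hab (P := Q.1 - k • linForm l ^ m)
    ((homogeneousSubmodule (Fin 2) ℂ m).sub_mem Q.2
      (Submodule.smul_mem _ _ (isHomogeneous_linForm_pow l m))) (by
    simp only [map_sub, Derivation.map_smul, hder, smul_sub]
    have h1 : (a * k * (m * l 0) + b * k * (m * l 1)) • linForm l ^ (m - 1) =
        linForm l ^ (m - 1) := by
      rw [show a * k * (m * l 0) + b * k * (m * l 1) = k * (m * s) by rw [hs_def]; ring, hk,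
        inv_mul_cancel₀ (mul_ne_zero hm0 hs), one_smul]
    rw [sub_add_sub_comm, ← h, smul_smul, smul_smul, smul_smul, smul_smul, ← add_smul, h1,
      sub_self])
  have hQ' : ∀ i, pderiv i Q.1 = (k * (m * l i)) • linForm l ^ (m - 1) +
      (c * (m * ![b, -a] i)) • linForm ![b, -a] ^ (m - 1) := fun i => by
    rw [sub_eq_iff_eq_add.1 hc, map_add, Derivation.map_smul, Derivation.map_smul, hder, hder,
      smul_smul, smul_smul, add_comm]
  have hmem : ∀ i, (c * (m * ![b, -a] i)) • linForm ![b, -a] ^ (m - 1) ∈ jacobianIdeal Q.1 :=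
    fun i => by
    have h1 : pderiv i Q.1 - (k * (m * l i)) • linForm l ^ (m - 1) ∈ jacobianIdeal Q.1 := by
      refine Ideal.sub_mem _ (Ideal.subset_span ⟨i, rfl⟩) (Submodule.smul_of_tower_mem _ _ ?_)
      rw [h]
      exact Ideal.add_mem _ (Submodule.smul_of_tower_mem _ _ (Ideal.subset_span ⟨0, rfl⟩))
        (Submodule.smul_of_tower_mem _ _ (Ideal.subset_span ⟨1, rfl⟩))
    rwa [hQ' i, add_sub_cancel_left] at h1
  have hc0 : c ≠ 0 := by
    rintro rfl
    have hp : ![l 1, -l 0] = 0 := eq_zero_of_eval_pderiv_eq_zero hm hQ fun i => by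
      rw [hQ' i, zero_mul, zero_smul, add_zero, smul_eval, map_pow, eval_linForm]
      simp [mul_comm, show m - 1 ≠ 0 by omega]
    refine hl (funext fun i => ?_)
    fin_cases i
    · simpa using congrFun hp 1
    · simpa using congrFun hp 0
  obtain ⟨i, hi⟩ : ∃ i, ![b, -a] i ≠ 0 := by
    rcases hab with ha | hb
    · exact ⟨1, by simpa using ha⟩
    · exact ⟨0, by simpa using hb⟩
  have hne : c * (m * ![b, -a] i) ≠ 0 := mul_ne_zero hc0 (mul_ne_zero hm0 hi)
  have := Submodule.smul_of_tower_mem _ (c * (m * ![b, -a] i))⁻¹ (hmem i)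
  rwa [smul_smul, inv_mul_cancel₀ hne, one_smul] at this

/-- The Jacobian ideal contains the `(m - 1)`-st powers of two independent linear forms `l`, `l'`.
Among the products `l ^ i * l' ^ j` of degree `2 * (m - 2)` only the balanced one can pair
non-trivially, so expanding `linForm z` in this basis leaves a single binomial term. -/
theorem exists_associatedForm_eq_of_linForm_pow (hm : 3 ≤ m) (hQ : Q ∈ nondegenerateForms m)
    {a b : ℂ} {l : Fin 2 → ℂ} (hl : l ≠ 0)
    (h : linForm l ^ (m - 1) = a • pderiv 0 Q.1 + b • pderiv 1 Q.1) :
    ∃ (A : Matrix (Fin 2) (Fin 2) ℂ) (c : ℂ), A.det ≠ 0 ∧ c ≠ 0 ∧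
      (associatedForm Q).1 = c • lsub A (X 0 ^ (m - 2) * X 1 ^ (m - 2)) := by
  have hs := eval_linForm_ne_zero_of_linForm_pow hm hQ hl h
  have hl₂ := linForm_pow_mem_jacobianIdeal hm hQ hl h
  have hl₁ : linForm l ^ (m - 1) ∈ jacobianIdeal Q.1 := by
    rw [h]
    exact Ideal.add_mem _ (Submodule.smul_of_tower_mem _ _ (Ideal.subset_span ⟨0, rfl⟩))
      (Submodule.smul_of_tower_mem _ _ (Ideal.subset_span ⟨1, rfl⟩))
  set L : Matrix (Fin 2) (Fin 2) ℂ := Matrix.of ![l, ![b, -a]] with hL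
  have hLdet : IsUnit L.det := by
    rw [isUnit_iff_ne_zero, hL, Matrix.det_fin_two]
    simp only [Matrix.of_apply, Matrix.cons_val_zero, Matrix.cons_val_one]
    intro h0
    exact hs (by linear_combination -h0)
  have hvan : ∀ i j, i + j = 2 * (m - 2) → i ≠ m - 2 →
      pairing (associatedForm Q) (linForm l ^ i * linForm ![b, -a] ^ j) = 0 := by
    intro i j hij hi
    refine (pairing_associatedForm_eq_zero_iff hm hQ ?_).2 ?_
    · exact hij ▸ (isHomogeneous_linForm_pow _ _).mul (isHomogeneous_linForm_pow _ _)
    · rcases Nat.lt_or_gt_of_ne hi with hi | hi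
      · exact Ideal.mul_mem_left _ _ (Ideal.mem_of_dvd _ (pow_dvd_pow _ (by omega)) hl₂)
      · exact Ideal.mul_mem_right _ _ (Ideal.mem_of_dvd _ (pow_dvd_pow _ (by omega)) hl₁)
  set c : ℂ := (2 * (m - 2)).choose (m - 2) *
    pairing (associatedForm Q) (linForm l ^ (m - 2) * linForm ![b, -a] ^ (m - 2)) with hc
  have hFeq : (associatedForm Q).1 = c • lsub (L⁻¹).transpose (X 0 ^ (m - 2) * X 1 ^ (m - 2)) := by
    refine MvPolynomial.funext fun z => ?_
    set w := Matrix.vecMul z L⁻¹ with hw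
    have hz : linForm z = lsub L (linForm w) := by
      rw [lsub_linForm, hw, Matrix.vecMul_vecMul, Matrix.nonsing_inv_mul _ hLdet, Matrix.vecMul_one]
    rw [eval_eq_pairing, hz, ← map_pow, linForm_pow, map_sum, map_sum, Finset.sum_eq_single (m - 2)]
    · rw [map_smul, map_smul (pairing _), show 2 * (m - 2) - (m - 2) = m - 2 by omega,
        lsub_X_pow_mul_X_pow, smul_eval, eval_lsub, Matrix.mulVec_transpose, ← hw, map_mul (eval w),
        map_pow (eval w), map_pow (eval w), eval_X, eval_X, smul_eq_mul, hc]
      change _ * pairing (associatedForm Q)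
        (linForm l ^ (m - 2) * linForm ![b, -a] ^ (m - 2)) = _
      ring
    · intro j hj hjN
      have := Finset.mem_range.1 hj
      rw [map_smul, map_smul (pairing _), lsub_X_pow_mul_X_pow]
      refine smul_eq_zero_of_right _ (hvan _ _ (by omega) (by omega))
    · intro hN'
      exact absurd (Finset.mem_range.2 (by omega)) hN'
  refine ⟨(L⁻¹).transpose, c, ?_, ?_, hFeq⟩
  · rw [Matrix.det_transpose]
    exact (Matrix.isUnit_nonsing_inv_det _ hLdet).ne_zero
  · intro h0
    refine ne_zero_of_mem_nonzeroCat (associatedForm_mem_nonzeroCat hm hQ) ?_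
    rw [hFeq, h0, zero_smul]

end Nondegenerate

/-! ### Closedness in the Zariski topology -/

theorem isClosed_subtype_of_exists_polyFun {n d : ℕ} {Y S : Set (Form n d)}
    (h : ∀ G₀ ∈ Y, G₀ ∉ S → ∃ D : Form n d → ℂ, IsPolyFun D ∧ D G₀ ≠ 0 ∧ ∀ G ∈ S, D G = 0) :
    IsClosed {F : Y | (F : Form n d) ∈ S} := by
  let I : Set (MvPolynomial (Fin n →₀ ℕ) ℂ) :=
    {p | ∀ G ∈ S, eval (fun s => coeff s G.1) p = 0}
  have hcl : IsClosed (zeroSet n d I) := by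
    rw [← isOpen_compl_iff]
    change (zeroSet n d I)ᶜᶜ ∈ Set.range (zeroSet n d)
    rw [compl_compl]
    exact ⟨I, rfl⟩
  refine isClosed_induced_iff.2 ⟨zeroSet n d I, hcl, ?_⟩
  ext F
  refine ⟨fun hF => ?_, fun hF p hp => hp _ hF⟩
  by_contra hFS
  obtain ⟨D, ⟨p, hp⟩, hD₀, hD⟩ := h F.1 F.2 hFS
  refine hD₀ ((hp _).trans (hF p fun G hG => ?_))
  rw [← hp, hD G hG]

end AssocForm
end

/-- For a binary form `Q` of degree `m ≥ 3` with non-zero discriminant, the `GL(2, ℂ)`-orbit of the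
associated form lies in the variety of binary forms of degree `2(m - 2)` with non-zero
catalecticant, and is closed in it. -/
theorem corollary4p4 (m : ℕ) (hm : 3 ≤ m) (Q : AssocForm.Form 2 m)
    (hQ : Q ∈ AssocForm.nondegenerateForms m) :
    AssocForm.glOrbit (AssocForm.associatedForm Q) ⊆ AssocForm.nonzeroCat (m - 2) ∧
    IsClosed {F : AssocForm.nonzeroCat (m - 2) |
      (F : AssocForm.Form 2 (2 * (m - 2))) ∈
        AssocForm.glOrbit (AssocForm.associatedForm Q)} := by
  have hF := AssocForm.associatedForm_mem_nonzeroCat hm hQ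
  refine ⟨AssocForm.glOrbit_subset_nonzeroCat hF,
    AssocForm.isClosed_subtype_of_exists_polyFun fun G₀ hG₀ hG₀F => ?_⟩
  obtain ⟨n, rfl⟩ : ∃ n, m = n + 3 := ⟨m - 3, by omega⟩
  -- With `m = n + 3`, the degree `n + 2` is that of the partials of `Q`. So failure of `hst` means
  -- that some combination of the partials is a power of a non-zero linear form.
  by_cases hst : ∀ l, AssocForm.IsApolar (n := n) (AssocForm.associatedForm Q)
      (AssocForm.linForm l ^ (n + 2)) → l = 0
  · exact AssocForm.exists_polyFun_of_stable hF hst hG₀ hG₀F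
  · push Not at hst
    obtain ⟨l, hl, hl0⟩ := hst
    obtain ⟨a, b, hab⟩ := AssocForm.exists_eq_smul_pderiv_add_smul_pderiv hm hQ
      (AssocForm.isHomogeneous_linForm_pow l _) hl
    obtain ⟨A, c, hA, hc, hFA⟩ :=
      AssocForm.exists_associatedForm_eq_of_linForm_pow hm hQ hl0 hab
    exact AssocForm.exists_polyFun_of_polystable hA hc hF hFA hG₀ hG₀F
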